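/- **Setting.** Let $p_1,p_2\ge 1$, $k_1\le p_1$, $k_2\le p_2$, $p=p_1+p_2$, $T>0$, and let $W_1,\dots,W_4$ be independent standard Wiener processes of dimensions $r_1,\dots,r_4$ on a stochastic basis $(\Omega,\mathscr F,\{\mathscr F_t\},\mathbf P)$ satisfying the usual conditions. A *parameter* is a tuple $a=(\Lambda_1,\Lambda_2,B,\Gamma,S_1,S_2,S_3,S_4)$ of real matrices of sizes $p_1\times k_1$, $p_2\times k_2$, $k_2\times k_2$, $k_2\times k_1$, $k_1\times r_1$, $p_1\times r_2$, $p_2\times r_3$, $k_2\times r_4$; it is *admissible* if $B$ has zero diagonal, $\Lambda_1$ has full column rank, $\Psi=I-B$ is non-singular, and $S_2S_2^\top$, $S_3S_3^\top$ are positive definite. Its covariance structure is $$\Sigma(a)=\begin{pmatrix}\Sigma^{11}&\Sigma^{12}\\ \Sigma^{12\top}&\Sigma^{22}\end{pmatrix},\quad \begin{aligned}\Sigma^{11}&=\Lambda_1S_1S_1^\top\Lambda_1^\top+S_2S_2^\top,\\ \Sigma^{12}&=\Lambda_1S_1S_1^\top\Gamma^\top\Psi^{-1\top}\Lambda_2^\top,\\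 \Sigma^{22}&=\Lambda_2\Psi^{-1}(\Gamma S_1S_1^\top\Gamma^\top+S_4S_4^\top)\Psi^{-1\top}\Lambda_2^\top+S_3S_3^\top.\end{aligned}$$ *True model.* Let $a_0$ be an admissible parameter, $\Sigma_0=\Sigma(a_0)$, and let $\xi,\delta,\varepsilon,\zeta$ be continuous adapted solutions of $$d\xi_t=B_1(\xi_t)dt+S_1dW_{1,t},\quad d\delta_t=B_2(\delta_t)dt+S_2dW_{2,t},\quad d\varepsilon_t=B_3(\varepsilon_t)dt+S_3dW_{3,t},\quad d\zeta_t=B_4(\zeta_t)dt+S_4dW_{4,t}$$ with deterministic initial values $c_1,\dots,c_4$. Let $\eta_t=B\eta_t+\Gamma\xi_t+\zeta_t$, $X_{1,t}=\Lambda_1\xi_t+\delta_t$, $X_{2,t}=\Lambda_2\eta_t+\varepsilon_t$ (all matrices being those of $a_0$). The process $\mathbb X_t=(X_{1,t}^\top,X_{2,t}^\top)^\top$ is observed at $t_i^n=ih_n$, $0\le i\le n$, where $h_n=T/n$; put $\Delta_i\mathbb X=\mathbb X_{t_i^n}-\mathbb X_{t_{i-1}^n}$. *Candidate models.* For $m=1,\dots,M$,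 Model $m$ consists of a convex compact set $\Theta_m\subset\mathbb R^{q_m}$ with non-empty interior and a map $\theta\mapsto a_m(\theta)$ to parameters, admissible for $\theta\in\Theta_m$, such that $\Sigma_m(\theta)=\Sigma(a_m(\theta))$ is $C^2$ on $\Theta_m$ (up to the boundary). Derivatives in $\theta$ are taken within $\Theta_m$. With $A[B]=\operatorname{tr}(AB^\top)$, let $$\mathbb L_{m,n}(\theta)=\prod_{i=1}^n\frac{1}{(2\pi h_n)^{p/2}\det\Sigma_m(\theta)^{1/2}}\exp\Bigl(-\frac1{2h_n}\Sigma_m(\theta)^{-1}\bigl[\Delta_i\mathbb X\,\Delta_i\mathbb X^\top\bigr]\Bigr),\qquad \mathbb H_{m,n}(\theta)=\log\bigl\{(2\pi h_n)^{np/2}\,\mathbb L_{m,n}(\theta)\bigr\},$$ let $\hat\theta_{m,n}\in\Theta_m$ satisfy $\mathbb L_{m,n}(\hat\theta_{m,n})=\sup_{\Theta_m}\mathbb L_{m,n}$ almost surely, and let $\tilde\Gamma_{m,n}$ be $-n^{-1}\partial^2_\theta\mathbb H_{m,n}(\hat\theta_{m,n})$ where this matrix is positive definite and the identity matrix elsewhere.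 Define $$\mathrm{QBIC}^{(m)}_{1,n}=-2\mathbb H_{m,n}(\hat\theta_{m,n})+\log\det(n\tilde\Gamma_{m,n}),\qquad \mathrm{QBIC}^{(m)}_{2,n}=-2\mathbb H_{m,n}(\hat\theta_{m,n})+q_m\log n .$$ Let $\pi_{m,n}$ be a prior density on $\Theta_m$ and let $$\mathbb H_{m,0}(\theta)=-\tfrac12\Sigma_m(\theta)^{-1}[\Sigma_0]-\tfrac12\log\det\Sigma_m(\theta).$$ Let $\mathfrak M$ be the set of correctly specified models, i.e. of those $m$ for which some $\theta_{m,0}\in\Theta_m$ satisfies $\Sigma_0=\Sigma_m(\theta_{m,0})$. Assume that $\mathfrak M$ is non-empty and that $m^*\in\mathfrak M$ is the unique minimizer of $q_m$ over $m\in\mathfrak M$. **Assumptions.** * [A] For each pair $(b,Z)\in\{(B_1,\xi),(B_2,\delta),(B_3,\varepsilon),(B_4,\zeta)\}$: $b$ is globally Lipschitz; $\sup_{t\ge0}\mathbf E|Z_t|^\ell<\infty$ for all $\ell>0$; $b$ is $C^4$, and $b$ and its derivatives up to order 4 have polynomial growth. * [B] For every $m$, $\sup_{\theta\in\Theta_m,\,n\ge1}\pi_{m,n}(\theta)<\infty$.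 For every $m\in\mathfrak M$ and $\theta_{m,0}\in\Theta_m$ with $\Sigma_0=\Sigma_m(\theta_{m,0})$: $\inf_{n\ge1}\pi_{m,n}(\theta_{m,0})>0$, and for each $L>0$, as $n\to\infty$, $$\sup\bigl\{|\pi_{m,n}(\theta_{m,0}+n^{-1/2}u)-\pi_{m,n}(\theta_{m,0})| : |u|<L,\ \theta_{m,0}+n^{-1/2}u\in\Theta_m\bigr\}\to0 .$$ * [C2] For every $m$, there is $\bar\theta_m\in\Theta_m$ with $\mathbb H_{m,0}(\bar\theta_m)=\sup_{\Theta_m}\mathbb H_{m,0}$; moreover (a) $\theta\in\Theta_m$ and $\mathbb H_{m,0}(\theta)=\mathbb H_{m,0}(\bar\theta_m)$ imply $\theta=\bar\theta_m$, and (b) $-\partial_\theta^2\mathbb H_{m,0}(\bar\theta_m)$ is positive definite. **Theorem.** Under [A], [B] and [C2], for every misspecified model $m\in\{1,\dots,M\}\setminus\mathfrak M$, as $n\to\infty$, $$\mathbf P\bigl(\mathrm{QBIC}^{(m^*)}_{1,n}<\mathrm{QBIC}^{(m)}_{1,n}\bigr)\to1\qquad\text{and}\qquad \mathbf P\bigl(\mathrm{QBIC}^{(m^*)}_{2,n}<\mathrm{QBIC}^{(m)}_{2,n}\bigr)\to1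 .$$ -/

import Mathlib

open MeasureTheory ProbabilityTheory Filter Topology
open scoped NNReal ENNReal Matrix

namespace DiffSEM

noncomputable section

/-- Real Euclidean space of dimension `d`. -/
abbrev E (d : ℕ) : Type := EuclideanSpace ℝ (Fin d)

/-! ### Structural parameters and the implied covariance -/

/-- The matrices of a structural equation model with latent variables.
`r 0, r 1, r 2, r 3` are the dimensions of the four driving Wiener processes. -/
structure Param (p₁ p₂ k₁ k₂ : ℕ) (r : Fin 4 → ℕ) where
  Λ₁ : Matrix (Fin p₁) (Fin k₁) ℝ
  Λ₂ : Matrix (Fin p₂) (Fin k₂) ℝ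
  B : Matrix (Fin k₂) (Fin k₂) ℝ
  Γ : Matrix (Fin k₂) (Fin k₁) ℝ
  S₁ : Matrix (Fin k₁) (Fin (r 0)) ℝ
  S₂ : Matrix (Fin p₁) (Fin (r 1)) ℝ
  S₃ : Matrix (Fin p₂) (Fin (r 2)) ℝ
  S₄ : Matrix (Fin k₂) (Fin (r 3)) ℝ

namespace Param

variable {p₁ p₂ k₁ k₂ : ℕ} {r : Fin 4 → ℕ}

/-- `Ψ = I - B`. -/
def Ψ (a : Param p₁ p₂ k₁ k₂ r) : Matrix (Fin k₂) (Fin k₂) ℝ := 1 - a.B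

/-- `B` has zero diagonal, `Λ₁` has full column rank, `Ψ` is non-singular, and the unique-factor
covariances `S₂ S₂ᵀ`, `S₃ S₃ᵀ` are positive definite. -/
structure Admissible (a : Param p₁ p₂ k₁ k₂ r) : Prop where
  diag_zero : ∀ i, a.B i i = 0
  rank_Λ₁ : a.Λ₁.rank = k₁
  nonsing : IsUnit a.Ψ
  posDef_δ : (a.S₂ * a.S₂ᵀ).PosDef
  posDef_ε : (a.S₃ * a.S₃ᵀ).PosDef

def cov₁₁ (a : Param p₁ p₂ k₁ k₂ r) : Matrix (Fin p₁) (Fin p₁) ℝ :=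
  a.Λ₁ * (a.S₁ * a.S₁ᵀ) * a.Λ₁ᵀ + a.S₂ * a.S₂ᵀ

def cov₁₂ (a : Param p₁ p₂ k₁ k₂ r) : Matrix (Fin p₁) (Fin p₂) ℝ :=
  a.Λ₁ * (a.S₁ * a.S₁ᵀ) * a.Γᵀ * (a.Ψ⁻¹)ᵀ * a.Λ₂ᵀ

def cov₂₂ (a : Param p₁ p₂ k₁ k₂ r) : Matrix (Fin p₂) (Fin p₂) ℝ :=
  a.Λ₂ * a.Ψ⁻¹ * (a.Γ * (a.S₁ * a.S₁ᵀ) * a.Γᵀ + a.S₄ * a.S₄ᵀ) * (a.Ψ⁻¹)ᵀ * a.Λ₂ᵀ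
    + a.S₃ * a.S₃ᵀ

/-- The covariance structure `Σ`, indexed by `p = p₁ + p₂` coordinates. -/
def cov (a : Param p₁ p₂ k₁ k₂ r) : Matrix (Fin p₁ ⊕ Fin p₂) (Fin p₁ ⊕ Fin p₂) ℝ :=
  Matrix.fromBlocks a.cov₁₁ a.cov₁₂ a.cov₁₂ᵀ a.cov₂₂

end Param

/-- A parametric candidate model: dimension, parameter set, parametrization. -/
structure Model (p₁ p₂ k₁ k₂ : ℕ) (r : Fin 4 → ℕ) where
  q : ℕ
  Θ : Set (E q)
  param : E q → Param p₁ p₂ k₁ k₂ r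

namespace Model

variable {p₁ p₂ k₁ k₂ : ℕ} {r : Fin 4 → ℕ}

/-- The covariance structure `Σ_m(θ)`. -/
def cov (m : Model p₁ p₂ k₁ k₂ r) (θ : E m.q) :
    Matrix (Fin p₁ ⊕ Fin p₂) (Fin p₁ ⊕ Fin p₂) ℝ :=
  (m.param θ).cov

/-- Standing assumptions on a candidate model. A nonempty compact convex set has a locally
Lipschitz boundary (as the closure of a domain) exactly when its interior is nonempty.
Smoothness is up to the boundary: derivatives are taken within `Θ`. -/
structure Regular (m : Model p₁ p₂ k₁ k₂ r) : Prop where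
  convex : Convex ℝ m.Θ
  compact : IsCompact m.Θ
  interior_nonempty : (interior m.Θ).Nonempty
  admissible : ∀ θ ∈ m.Θ, (m.param θ).Admissible
  smooth : ∀ i j, ContDiffOn ℝ 2 (fun θ ↦ m.cov θ i j) m.Θ

/-- Model `m` is correctly specified for the true covariance `V₀`. -/
def Correct (m : Model p₁ p₂ k₁ k₂ r)
    (V₀ : Matrix (Fin p₁ ⊕ Fin p₂) (Fin p₁ ⊕ Fin p₂) ℝ) : Prop :=
  ∃ θ₀ ∈ m.Θ, V₀ = m.cov θ₀

end Model

/-- `mstar` is the unique minimizer of the dimension among the correctly specified models. -/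
def IsOptimalModel {p₁ p₂ k₁ k₂ M : ℕ} {r : Fin 4 → ℕ} (model : Fin M → Model p₁ p₂ k₁ k₂ r)
    (V₀ : Matrix (Fin p₁ ⊕ Fin p₂) (Fin p₁ ⊕ Fin p₂) ℝ) (mstar : Fin M) : Prop :=
  (model mstar).Correct V₀ ∧
    ∀ m, (model m).Correct V₀ → m ≠ mstar → (model mstar).q < (model m).q

/-! ### The stochastic basis, Wiener processes, and the true model -/

section Stochastic

variable {Ω : Type*} {mΩ : MeasurableSpace Ω}

/-- The usual conditions: right-continuity, and every null set belongs to the initial σ-algebra. -/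
structure UsualConditions (ℱ : Filtration ℝ≥0 mΩ) (P : Measure Ω) : Prop where
  rightCont : ℱ.IsRightContinuous
  complete : ∀ s : Set Ω, P s = 0 → MeasurableSet[ℱ 0] s

/-- `W` is an `r`-dimensional standard Wiener process with respect to the filtration `ℱ`. -/
structure IsWiener {r : ℕ} (ℱ : Filtration ℝ≥0 mΩ) (P : Measure Ω)
    (W : ℝ≥0 → Ω → (Fin r → ℝ)) : Prop where
  adapted : Adapted ℱ W
  brownian : ∀ j, IsBrownianReal (fun t ω ↦ W t ω j) P
  indep_coord : iIndepFun (fun (j : Fin r) (ω : Ω) (t : ℝ≥0) ↦ W t ω j) P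
  indep_past : ∀ s t : ℝ≥0, s ≤ t →
    Indep (MeasurableSpace.comap (fun ω ↦ W t ω - W s ω) inferInstance) (ℱ s) P

/-- `Z` is a continuous adapted solution of `dZ = b(Z) dt + S dW`, `Z₀ = c`. The diffusion matrix
is constant, so that the stochastic integral of `S` is `S W_t`. -/
structure SolvesSDE {d r : ℕ} (ℱ : Filtration ℝ≥0 mΩ) (P : Measure Ω) (b : E d → E d)
    (S : Matrix (Fin d) (Fin r) ℝ) (W : ℝ≥0 → Ω → (Fin r → ℝ)) (c : E d)
    (Z : ℝ≥0 → Ω → E d) : Prop where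
  adapted : Adapted ℱ Z
  continuous : ∀ᵐ ω ∂P, Continuous (fun t ↦ Z t ω)
  eqn : ∀ᵐ ω ∂P, ∀ (t : ℝ≥0) (i : Fin d),
    Z t ω i = c i + (∫ s in (0 : ℝ)..(t : ℝ), b (Z s.toNNReal ω) i) + (S *ᵥ W t ω) i

/-- `f` is `C^k` and `f` and all its derivatives up to order `k` have polynomial growth. -/
def CPoly {d : ℕ} (k : ℕ) (f : E d → E d) : Prop :=
  ContDiff ℝ k f ∧
    ∀ j ≤ k, ∃ C : ℝ, ∃ N : ℕ, ∀ x, ‖iteratedFDeriv ℝ j f x‖ ≤ C * (1 + ‖x‖) ^ N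

/-- Condition on a drift `b` and the corresponding process `Z`: global Lipschitz continuity,
moments of every order bounded in time, and `C^4` with polynomial growth. -/
structure DriftCondition {d : ℕ} (P : Measure Ω) (b : E d → E d) (Z : ℝ≥0 → Ω → E d) : Prop where
  lipschitz : ∃ C : ℝ, 0 < C ∧ ∀ x y, ‖b x - b y‖ ≤ C * ‖x - y‖
  moments : ∀ l : ℝ, 0 < l → (⨆ t : ℝ≥0, ∫⁻ ω, ‖Z t ω‖ₑ ^ l ∂P) < ∞
  smooth : CPoly 4 b

/-- The drifts and initial values of the four latent diffusions. -/
structure DriftData (p₁ p₂ k₁ k₂ : ℕ) where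
  b₁ : E k₁ → E k₁
  b₂ : E p₁ → E p₁
  b₃ : E p₂ → E p₂
  b₄ : E k₂ → E k₂
  c₁ : E k₁
  c₂ : E p₁
  c₃ : E p₂
  c₄ : E k₂

/-- The latent processes `ξ, δ, ε, ζ, η` and the observable processes `X₁, X₂`. -/
structure Processes (Ω : Type*) (p₁ p₂ k₁ k₂ : ℕ) where
  ξ : ℝ≥0 → Ω → E k₁
  δ : ℝ≥0 → Ω → E p₁
  ε : ℝ≥0 → Ω → E p₂
  ζ : ℝ≥0 → Ω → E k₂
  η : ℝ≥0 → Ω → E k₂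
  X₁ : ℝ≥0 → Ω → E p₁
  X₂ : ℝ≥0 → Ω → E p₂

/-- The observed vector `X_t = (X₁ᵀ, X₂ᵀ)ᵀ`. -/
def Processes.X {p₁ p₂ k₁ k₂ : ℕ} (Y : Processes Ω p₁ p₂ k₁ k₂) (t : ℝ≥0) (ω : Ω) :
    Fin p₁ ⊕ Fin p₂ → ℝ :=
  Sum.elim (fun i ↦ Y.X₁ t ω i) (fun i ↦ Y.X₂ t ω i)

/-- The processes `Y` follow the structural equation model with matrices `a`, driven by the
independent Wiener processes `W 0, W 1, W 2, W 3`. -/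
structure IsSEM {p₁ p₂ k₁ k₂ : ℕ} {r : Fin 4 → ℕ} (ℱ : Filtration ℝ≥0 mΩ) (P : Measure Ω)
    (W : (i : Fin 4) → ℝ≥0 → Ω → (Fin (r i) → ℝ)) (D : DriftData p₁ p₂ k₁ k₂)
    (a : Param p₁ p₂ k₁ k₂ r) (Y : Processes Ω p₁ p₂ k₁ k₂) : Prop where
  wiener : ∀ i, IsWiener ℱ P (W i)
  indep : iIndepFun (fun (i : Fin 4) (ω : Ω) (t : ℝ≥0) ↦ W i t ω) P
  sde_ξ : SolvesSDE ℱ P D.b₁ a.S₁ (W 0) D.c₁ Y.ξ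
  sde_δ : SolvesSDE ℱ P D.b₂ a.S₂ (W 1) D.c₂ Y.δ
  sde_ε : SolvesSDE ℱ P D.b₃ a.S₃ (W 2) D.c₃ Y.ε
  sde_ζ : SolvesSDE ℱ P D.b₄ a.S₄ (W 3) D.c₄ Y.ζ
  eq_X₁ : ∀ᵐ ω ∂P, ∀ t i, Y.X₁ t ω i = (a.Λ₁ *ᵥ (Y.ξ t ω).ofLp) i + Y.δ t ω i
  eq_X₂ : ∀ᵐ ω ∂P, ∀ t i, Y.X₂ t ω i = (a.Λ₂ *ᵥ (Y.η t ω).ofLp) i + Y.ε t ω i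
  eq_η : ∀ᵐ ω ∂P, ∀ t i,
    Y.η t ω i = (a.B *ᵥ (Y.η t ω).ofLp) i + (a.Γ *ᵥ (Y.ξ t ω).ofLp) i + Y.ζ t ω i

/-- Assumption [A]: the drift condition for each of the four latent diffusions. -/
structure AssumptionA {p₁ p₂ k₁ k₂ : ℕ} (P : Measure Ω) (D : DriftData p₁ p₂ k₁ k₂)
    (Y : Processes Ω p₁ p₂ k₁ k₂) : Prop where
  ξ : DriftCondition P D.b₁ Y.ξ
  δ : DriftCondition P D.b₂ Y.δ
  ε : DriftCondition P D.b₃ Y.ε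
  ζ : DriftCondition P D.b₄ Y.ζ

end Stochastic

/-! ### Priors -/

/-- `π n` is a probability density on `Θ` for every `n ≥ 1`. -/
def IsPrior {q : ℕ} (Θ : Set (E q)) (π : ℕ → E q → ℝ) : Prop :=
  ∀ n, 1 ≤ n → (∀ θ ∈ Θ, 0 ≤ π n θ) ∧ IntegrableOn (π n) Θ ∧ ∫ θ in Θ, π n θ = 1

/-- Assumption [B] for one model with true covariance `V₀`; its clauses about the true parameter
`θ₀` concern the `θ₀ ∈ Θ` with `V₀ = V θ₀`. -/
structure AssumptionB {q : ℕ} {ι : Type*} (Θ : Set (E q)) (V : E q → Matrix ι ι ℝ)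
    (V₀ : Matrix ι ι ℝ) (π : ℕ → E q → ℝ) : Prop where
  bounded : ∃ C : ℝ, ∀ θ ∈ Θ, ∀ n, 1 ≤ n → π n θ ≤ C
  pos : ∀ θ₀ ∈ Θ, V₀ = V θ₀ → ∃ c : ℝ, 0 < c ∧ ∀ n, 1 ≤ n → c ≤ π n θ₀
  equicont : ∀ θ₀ ∈ Θ, V₀ = V θ₀ → ∀ L : ℝ, 0 < L → ∀ e : ℝ, 0 < e → ∀ᶠ n : ℕ in atTop,
    ∀ u : E q, ‖u‖ < L → θ₀ + (Real.sqrt n)⁻¹ • u ∈ Θ →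
      |π n (θ₀ + (Real.sqrt n)⁻¹ • u) - π n θ₀| ≤ e

/-! ### Quasi-likelihood and the information criteria -/

section Likelihood

variable {ι : Type*} [Fintype ι] [DecidableEq ι]

/-- `A[B] = tr(A Bᵀ)`. -/
def bracket (A B : Matrix ι ι ℝ) : ℝ := (A * Bᵀ).trace

/-- The quasi-likelihood of the covariance `V`, for the increments `Δ 0, …, Δ (n-1)` over time
steps of length `h`. -/
def quasiLik (V : Matrix ι ι ℝ) (h : ℝ) (n : ℕ) (Δ : ℕ → ι → ℝ) : ℝ :=
  ∏ i ∈ Finset.range n,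
    1 / ((2 * Real.pi * h) ^ ((Fintype.card ι : ℝ) / 2) * V.det ^ ((1 : ℝ) / 2)) *
      Real.exp (-(1 / (2 * h)) * bracket V⁻¹ (Matrix.vecMulVec (Δ i) (Δ i)))

/-- `ℍ_n = log ((2πh)^{np/2} 𝕃_n)`. -/
def quasiLogLik (V : Matrix ι ι ℝ) (h : ℝ) (n : ℕ) (Δ : ℕ → ι → ℝ) : ℝ :=
  Real.log ((2 * Real.pi * h) ^ ((n : ℝ) * (Fintype.card ι : ℝ) / 2) * quasiLik V h n Δ)

/-- The limit contrast `-½ V⁻¹[V₀] - ½ log det V`. -/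
def limitContrast (V₀ V : Matrix ι ι ℝ) : ℝ :=
  -(1 / 2) * bracket V⁻¹ V₀ - 1 / 2 * Real.log V.det

/-- The Hessian of `f` at `θ`, with derivatives taken within `Θ` (at interior points of `Θ`, the
usual Hessian). -/
def hessian {q : ℕ} (f : E q → ℝ) (Θ : Set (E q)) (θ : E q) : Matrix (Fin q) (Fin q) ℝ :=
  Matrix.of fun i j ↦ iteratedFDerivWithin ℝ 2 f Θ θ
    ![EuclideanSpace.single i 1, EuclideanSpace.single j 1]

open scoped Classical in
/-- `Γ̃_n`: the matrix `-n⁻¹ ∂²ℍ_n(θ)` if this is positive definite, the identity otherwise. -/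
def gammaTilde {q : ℕ} (H : E q → ℝ) (Θ : Set (E q)) (n : ℕ) (θ : E q) :
    Matrix (Fin q) (Fin q) ℝ :=
  if (-((n : ℝ)⁻¹ • hessian H Θ θ)).PosDef then -((n : ℝ)⁻¹ • hessian H Θ θ) else 1

/-- `QBIC₁` of the quasi-log likelihood `H`, at the estimate `θ`. -/
def qbic₁ {q : ℕ} (H : E q → ℝ) (Θ : Set (E q)) (n : ℕ) (θ : E q) : ℝ :=
  -2 * H θ + Real.log ((n : ℝ) • gammaTilde H Θ n θ).det

/-- `QBIC₂` of the quasi-log likelihood `H`, at the estimate `θ`. -/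
def qbic₂ {q : ℕ} (H : E q → ℝ) (n : ℕ) (θ : E q) : ℝ :=
  -2 * H θ + (q : ℝ) * Real.log n

/-- Assumption [C2] for one model: `θbar` is the unique maximizer over `Θ` of the limit contrast,
whose Hessian there is negative definite. -/
structure AssumptionC2 {q : ℕ} (Θ : Set (E q)) (V : E q → Matrix ι ι ℝ) (V₀ : Matrix ι ι ℝ)
    (θbar : E q) : Prop where
  mem : θbar ∈ Θ
  isMax : ∀ θ ∈ Θ, limitContrast V₀ (V θ) ≤ limitContrast V₀ (V θbar)
  unique : ∀ θ ∈ Θ, limitContrast V₀ (V θ) = limitContrast V₀ (V θbar) → θ = θbar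
  posDef : (-(hessian (fun θ ↦ limitContrast V₀ (V θ)) Θ θbar)).PosDef

end Likelihood

section Statistics

variable {Ω : Type*} {p₁ p₂ k₁ k₂ : ℕ} {r : Fin 4 → ℕ}

/-- The increments `X_{(i+1)T/n} - X_{iT/n}` of the observed process. -/
def incr (X : ℝ≥0 → Ω → (Fin p₁ ⊕ Fin p₂ → ℝ)) (T : ℝ≥0) (n : ℕ) (ω : Ω) (i : ℕ) :
    Fin p₁ ⊕ Fin p₂ → ℝ :=
  X (((i + 1 : ℕ) : ℝ≥0) * (T / n)) ω - X ((i : ℝ≥0) * (T / n)) ω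

/-- `𝕃_{m,n}(θ)`. -/
def Model.L (m : Model p₁ p₂ k₁ k₂ r) (X : ℝ≥0 → Ω → (Fin p₁ ⊕ Fin p₂ → ℝ)) (T : ℝ≥0) (n : ℕ)
    (ω : Ω) (θ : E m.q) : ℝ :=
  quasiLik (m.cov θ) ((T : ℝ) / n) n (incr X T n ω)

/-- `ℍ_{m,n}(θ)`. -/
def Model.H (m : Model p₁ p₂ k₁ k₂ r) (X : ℝ≥0 → Ω → (Fin p₁ ⊕ Fin p₂ → ℝ)) (T : ℝ≥0) (n : ℕ)
    (ω : Ω) (θ : E m.q) : ℝ :=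
  quasiLogLik (m.cov θ) ((T : ℝ) / n) n (incr X T n ω)

/-- `θhat` is a quasi-maximum likelihood estimator of model `m`. -/
def Model.IsQMLE {mΩ : MeasurableSpace Ω} (m : Model p₁ p₂ k₁ k₂ r) (P : Measure Ω)
    (X : ℝ≥0 → Ω → (Fin p₁ ⊕ Fin p₂ → ℝ)) (T : ℝ≥0) (θhat : ℕ → Ω → E m.q) : Prop :=
  ∀ n, 1 ≤ n → ∀ᵐ ω ∂P, θhat n ω ∈ m.Θ ∧ IsMaxOn (m.L X T n ω) m.Θ (θhat n ω)

/-- `QBIC_{1,n}^{(m)}`. -/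
def Model.QBIC₁ (m : Model p₁ p₂ k₁ k₂ r) (X : ℝ≥0 → Ω → (Fin p₁ ⊕ Fin p₂ → ℝ)) (T : ℝ≥0)
    (θhat : ℕ → Ω → E m.q) (n : ℕ) (ω : Ω) : ℝ :=
  qbic₁ (m.H X T n ω) m.Θ n (θhat n ω)

/-- `QBIC_{2,n}^{(m)}`. -/
def Model.QBIC₂ (m : Model p₁ p₂ k₁ k₂ r) (X : ℝ≥0 → Ω → (Fin p₁ ⊕ Fin p₂ → ℝ)) (T : ℝ≥0)
    (θhat : ℕ → Ω → E m.q) (n : ℕ) (ω : Ω) : ℝ :=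
  qbic₂ (m.H X T n ω) n (θhat n ω)

end Statistics

end

end DiffSEM

open DiffSEM

/-! The data enter a candidate model only through the realized covariance `Q = T⁻¹ ∑ Δᵢ Δᵢᵀ`:
`quasiLogLik_eq` shows that the normalized quasi-log likelihood is exactly `n * limitContrast Q (V
θ)`. All randomness thus sits in one matrix shared by all models, and the proof splits into a
probabilistic and a deterministic half.

Probabilistic half (`IsSEM.tendsto_realizedCov`): `Q` tends to the true covariance in probability.
The observed process is a linear image of the Wiener processes plus a pathwise Lipschitz drift part.
Drift terms vanish from the quadratic sums, and the Gaussian sums obey a law of large numbers.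

Deterministic half (`eventually_qbic_lt`): for `Q` near the truth, maximizers of the contrast lie
near `θbar`, so either criterion is `-2n` times the optimal limit contrast, up to an arbitrarily
small multiple of `n` plus `q log n + O(1)`. By the Gaussian information inequality
`limitContrast_lt_self`, a misspecified model has a strictly smaller optimal contrast than a correct
one. The resulting gap is linear in `n` and beats the logarithmic penalties. No limit law of the
estimators is needed, and `θbar` may lie on the boundary of `Θ`. -/

namespace DiffSEM

/-! ### Gaussian information inequality -/

section Information

variable {ι : Type*} [Fintype ι] [DecidableEq ι]

/-- Sum `1 + log x ≤ x` over the spectrum. Equality holds only at `x = 1`, and a Hermitian matrix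
whose eigenvalues are all `1` is the identity. -/
lemma card_add_log_det_lt_trace {A : Matrix ι ι ℝ} (hA : A.PosDef) (hne : A ≠ 1) :
    (Fintype.card ι : ℝ) + Real.log A.det < A.trace := by
  have hev : ∃ i, hA.1.eigenvalues i ≠ 1 := by
    by_contra! h
    apply hne
    have hs := hA.1.spectral_theorem
    have h1 : (RCLike.ofReal ∘ hA.1.eigenvalues : ι → ℝ) = 1 := by
      ext i; simp [h i]
    rw [h1, Matrix.diagonal_one', map_one] at hs
    exact hs
  obtain ⟨i, hi⟩ := hev
  rw [hA.1.trace_eq_sum_eigenvalues, hA.1.det_eq_prod_eigenvalues]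
  simp only [RCLike.ofReal_real_eq_id, id_eq]
  rw [Real.log_prod (fun j _ ↦ (hA.eigenvalues_pos j).ne'), ← Finset.card_univ, Finset.cast_card,
    ← Finset.sum_add_distrib]
  refine Finset.sum_lt_sum (fun j _ ↦ ?_) ⟨i, Finset.mem_univ i, ?_⟩
  · linarith [Real.log_le_sub_one_of_pos (hA.eigenvalues_pos j)]
  · linarith [Real.log_lt_sub_one_of_pos (hA.eigenvalues_pos i) hi]

open scoped MatrixOrder in
/-- The Gaussian information inequality: the limit contrast is maximal only at the truth. -/
lemma limitContrast_lt_self {V₀ V : Matrix ι ι ℝ} (h₀ : V₀.PosDef) (h : V.PosDef) (hne : V ≠ V₀) :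
    limitContrast V₀ V < limitContrast V₀ V₀ := by
  -- `V⁻¹ * V₀` need not be symmetric. With `V⁻¹ = Cᴴ * C` it is replaced by the positive definite
  -- `C * V₀ * Cᴴ`, which has the same trace and determinant and equals `1` only if `V = V₀`.
  obtain ⟨C, hC⟩ := CStarAlgebra.nonneg_iff_eq_star_mul_self.mp (h.inv.posSemidef.nonneg)
  have hdetV := h.det_pos
  have hdetV₀ := h₀.det_pos
  have hCdet : C.det ≠ 0 := by
    intro h0
    have := h.inv.det_pos
    rw [hC, Matrix.det_mul, h0, mul_zero] at this
    exact lt_irrefl _ this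
  have hCu : IsUnit C := (Matrix.isUnit_iff_isUnit_det C).2 hCdet.isUnit
  have hA : (C * V₀ * Cᴴ).PosDef := by
    refine h₀.mul_mul_conjTranspose_same ?_
    exact Matrix.vecMul_injective_of_isUnit hCu
  have hA1 : C * V₀ * Cᴴ ≠ 1 := by
    intro h1
    apply hne
    have h2 : V⁻¹ * V₀ = 1 := by
      have h3 : C * (V₀ * Cᴴ) = 1 := by rw [← mul_assoc, h1]
      have h4 : V₀ * Cᴴ * C = 1 := mul_eq_one_comm.mp h3
      rw [hC]
      refine mul_eq_one_comm.mp ?_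
      rw [Matrix.star_eq_conjTranspose, ← mul_assoc, h4]
    have hu : IsUnit V.det := hdetV.ne'.isUnit
    calc V = V * (V⁻¹ * V₀) := by rw [h2, mul_one]
      _ = V₀ := Matrix.mul_nonsing_inv_cancel_left _ _ hu
  have key := card_add_log_det_lt_trace hA hA1
  have htr : (C * V₀ * Cᴴ).trace = (V⁻¹ * V₀).trace := by
    rw [hC, Matrix.star_eq_conjTranspose, Matrix.trace_mul_comm, ← mul_assoc]
  have hdet : Real.log (C * V₀ * Cᴴ).det = Real.log V₀.det - Real.log V.det := by
    have : (C * V₀ * Cᴴ).det = V.det⁻¹ * V₀.det := by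
      rw [← Ring.inverse_eq_inv', ← Matrix.det_nonsing_inv, hC, Matrix.star_eq_conjTranspose]
      simp only [Matrix.det_mul]; ring
    rw [this, Real.log_mul (inv_ne_zero hdetV.ne') hdetV₀.ne', Real.log_inv]; ring
  have hsymm : V₀ᵀ = V₀ := (Matrix.conjTranspose_eq_transpose_of_trivial V₀).symm.trans h₀.1
  have hself : V₀⁻¹ * V₀ = 1 := Matrix.nonsing_inv_mul _ hdetV₀.ne'.isUnit
  simp only [limitContrast, bracket, hsymm, hself, Matrix.trace_one]
  rw [htr, hdet] at key
  linarith

end Information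

/-! ### Factorization and positivity of the covariance structure -/

namespace Param

variable {p₁ p₂ k₁ k₂ : ℕ} {r : Fin 4 → ℕ}

/-- The loadings of the observed process on the `i`-th driving Wiener process. -/
noncomputable def loading (a : Param p₁ p₂ k₁ k₂ r) : 
    (i : Fin 4) → Matrix (Fin p₁ ⊕ Fin p₂) (Fin (r i)) ℝ
  | 0 => Matrix.fromRows (a.Λ₁ * a.S₁) (a.Λ₂ * a.Ψ⁻¹ * a.Γ * a.S₁)
  | 1 => Matrix.fromRows a.S₂ 0
  | 2 => Matrix.fromRows 0 a.S₃
  | 3 => Matrix.fromRows 0 (a.Λ₂ * a.Ψ⁻¹ * a.S₄)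

/-- Identifies the model covariance with the covariance per unit time of the Gaussian part of the
observations, the form in which it arises as a limit. -/
lemma cov_eq_sum_loading (a : Param p₁ p₂ k₁ k₂ r) :
    a.cov = ∑ i, a.loading i * (a.loading i)ᵀ := by
  simp only [Fin.sum_univ_four, loading, Matrix.transpose_fromRows, Matrix.fromRows_mul_fromCols,
    Matrix.fromBlocks_add, cov, cov₁₁, cov₁₂, cov₂₂, Matrix.transpose_mul,
    Matrix.transpose_transpose, Matrix.transpose_zero, Matrix.mul_zero, Matrix.zero_mul, add_zero,
    Matrix.mul_assoc, Matrix.mul_add, Matrix.add_mul]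
  congr 1
  abel

/-- The loadings of the two unique factors give a positive definite block-diagonal matrix; the other
two loadings add Gram matrices, which are positive semidefinite. -/
lemma Admissible.posDef_cov {a : Param p₁ p₂ k₁ k₂ r} (ha : a.Admissible) : a.cov.PosDef := by
  have hblock : (Matrix.fromBlocks (a.S₂ * a.S₂ᵀ) 0 0 (a.S₃ * a.S₃ᵀ)).PosDef := by
    refine Matrix.PosDef.of_dotProduct_mulVec_pos ?_ fun x hx ↦ ?_
    · exact Matrix.IsHermitian.fromBlocks ha.posDef_δ.1 (by simp) ha.posDef_ε.1
    · rw [← Sum.elim_comp_inl_inr x, Matrix.fromBlocks_mulVec]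
      simp only [star_trivial, Sum.elim_comp_inl, Sum.elim_comp_inr, Matrix.zero_mulVec, add_zero,
        zero_add, _root_.sumElim_dotProduct_sumElim]
      by_cases h1 : x ∘ Sum.inl = 0
      · have h2 : x ∘ Sum.inr ≠ 0 := fun h2 ↦ hx (by
          rw [← Sum.elim_comp_inl_inr x, h1, h2]; ext (i | i) <;> rfl)
        have := ha.posDef_ε.dotProduct_mulVec_pos h2
        simpa [h1] using this
      · have h3 := ha.posDef_δ.dotProduct_mulVec_pos h1
        have h4 := ha.posDef_ε.posSemidef.dotProduct_mulVec_nonneg (x ∘ Sum.inr)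
        simp only [star_trivial] at h3 h4
        exact add_pos_of_pos_of_nonneg h3 h4
  have hsum : a.cov = Matrix.fromBlocks (a.S₂ * a.S₂ᵀ) 0 0 (a.S₃ * a.S₃ᵀ)
      + (a.loading 0 * (a.loading 0)ᴴ + a.loading 3 * (a.loading 3)ᴴ) := by
    rw [cov_eq_sum_loading]
    simp only [Fin.sum_univ_four, loading, Matrix.conjTranspose_eq_transpose_of_trivial,
      Matrix.transpose_fromRows, Matrix.fromRows_mul_fromCols, Matrix.fromBlocks_add,
      Matrix.transpose_zero, Matrix.mul_zero, Matrix.zero_mul, add_zero, zero_add]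
    congr 1
    all_goals abel
  rw [hsum]
  exact hblock.add_posSemidef ((Matrix.posSemidef_self_mul_conjTranspose _).add
    (Matrix.posSemidef_self_mul_conjTranspose _))

end Param

/-! ### Regularity of the contrast in the parameter and the data matrix -/

section Smoothness

variable {F : Type*} [NormedAddCommGroup F] [NormedSpace ℝ F] {s : Set F} {k : WithTop ℕ∞}
variable {ι : Type*} [Fintype ι] [DecidableEq ι] {V : F → Matrix ι ι ℝ}

lemma contDiffOn_det (hV : ∀ i j, ContDiffOn ℝ k (fun x ↦ V x i j) s) :
    ContDiffOn ℝ k (fun x ↦ (V x).det) s := by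
  simp only [Matrix.det_apply]
  refine ContDiffOn.sum fun σ _ ↦ ?_
  exact (contDiffOn_prod fun i _ ↦ hV _ _).const_smul _

lemma contDiffOn_inv_apply (hV : ∀ i j, ContDiffOn ℝ k (fun x ↦ V x i j) s)
    (hdet : ∀ x ∈ s, (V x).det ≠ 0) (i j : ι) : ContDiffOn ℝ k (fun x ↦ (V x)⁻¹ i j) s := by
  simp only [Matrix.inv_def, Matrix.smul_apply, Ring.inverse_eq_inv', smul_eq_mul,
    Matrix.adjugate_apply]
  -- Cramer's rule: an adjugate entry is the determinant of `V x` with one row replaced by a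
  -- constant vector.
  refine ((contDiffOn_det hV).inv hdet).mul (contDiffOn_det fun a b ↦ ?_)
  by_cases h : a = j
  · subst h
    simpa using contDiffOn_const
  · simpa [Matrix.updateRow_ne h] using hV a b

/-- The contrast is affine in `Q`, with coefficients depending on `V` alone. Joint regularity in
`(Q, θ)` therefore reduces to regularity in `θ`. -/
lemma limitContrast_eq_sum (Q V : Matrix ι ι ℝ) :
    limitContrast Q V
      = (∑ i, ∑ j, (-(1 / 2) * Q i j) * V⁻¹ i j) + -(1 / 2) * Real.log V.det := by
  simp only [limitContrast, bracket, Matrix.trace, Matrix.diag_apply, Matrix.mul_apply,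
    Matrix.transpose_apply, Finset.mul_sum]
  rw [sub_eq_add_neg]
  congr 1
  · refine Finset.sum_congr rfl fun i _ ↦ Finset.sum_congr rfl fun j _ ↦ ?_
    ring
  · ring

lemma contDiffOn_log_det (hV : ∀ i j, ContDiffOn ℝ k (fun x ↦ V x i j) s)
    (hdet : ∀ x ∈ s, (V x).det ≠ 0) :
    ContDiffOn ℝ k (fun x ↦ -(1 / 2) * Real.log (V x).det) s :=
  contDiffOn_const.mul ((contDiffOn_det hV).log hdet)

lemma contDiffOn_limitContrast (hV : ∀ i j, ContDiffOn ℝ k (fun x ↦ V x i j) s)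
    (hdet : ∀ x ∈ s, (V x).det ≠ 0) (Q : Matrix ι ι ℝ) :
    ContDiffOn ℝ k (fun x ↦ limitContrast Q (V x)) s := by
  simp only [limitContrast_eq_sum]
  exact (ContDiffOn.sum fun i _ ↦ ContDiffOn.sum fun j _ ↦
    contDiffOn_const.mul (contDiffOn_inv_apply hV hdet i j)).add (contDiffOn_log_det hV hdet)

lemma continuousOn_limitContrast (hV : ∀ i j, ContDiffOn ℝ k (fun x ↦ V x i j) s)
    (hdet : ∀ x ∈ s, (V x).det ≠ 0) :
    ContinuousOn (fun z : Matrix ι ι ℝ × F ↦ limitContrast z.1 (V z.2)) (Set.univ ×ˢ s) := by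
  have hm : Set.MapsTo (Prod.snd : Matrix ι ι ℝ × F → F) (Set.univ ×ˢ s) s := fun z hz ↦ hz.2
  simp only [limitContrast_eq_sum]
  refine ContinuousOn.add (continuousOn_finsetSum _ fun i _ ↦ continuousOn_finsetSum _ fun j _ ↦
    ContinuousOn.mul (Continuous.continuousOn (by fun_prop)) ?_) ?_
  · exact (contDiffOn_inv_apply hV hdet i j).continuousOn.comp continuousOn_snd hm
  · exact (contDiffOn_log_det hV hdet).continuousOn.comp continuousOn_snd hm

end Smoothness

/-! ### Hessians within the parameter set -/

section Hessian

variable {q : ℕ} {Θ : Set (E q)} {ι : Type*} [Fintype ι] [DecidableEq ι]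
variable {V : E q → Matrix ι ι ℝ}

lemma hessian_congr {f g : E q → ℝ} (h : Set.EqOn f g Θ) {θ : E q} (hθ : θ ∈ Θ) :
    hessian f Θ θ = hessian g Θ θ := by
  simp only [hessian, iteratedFDerivWithin_congr h hθ]

lemma hessian_const_mul {f : E q → ℝ} (hf : ContDiffOn ℝ 2 f Θ) (hΘ : UniqueDiffOn ℝ Θ) (c : ℝ)
    {θ : E q} (hθ : θ ∈ Θ) : hessian (fun x ↦ c * f x) Θ θ = c • hessian f Θ θ := by
  ext i j
  have := iteratedFDerivWithin_const_smul_apply (a := c) (i := 2) (hf θ hθ) hΘ hθ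
  simp only [hessian, Matrix.of_apply, Matrix.smul_apply]
  change iteratedFDerivWithin ℝ 2 (c • f) Θ θ _ = _
  rw [this]; rfl

lemma hessian_limitContrast_apply (hΘ : UniqueDiffOn ℝ Θ)
    (hV : ∀ i j, ContDiffOn ℝ 2 (fun θ ↦ V θ i j) Θ) (hdet : ∀ θ ∈ Θ, (V θ).det ≠ 0)
    (Q : Matrix ι ι ℝ) {θ : E q} (hθ : θ ∈ Θ) (a b : Fin q) :
    hessian (fun θ ↦ limitContrast Q (V θ)) Θ θ a b
      = (∑ i, ∑ j, (-(1 / 2) * Q i j) * hessian (fun θ ↦ (V θ)⁻¹ i j) Θ θ a b)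
        + hessian (fun θ ↦ -(1 / 2) * Real.log (V θ).det) Θ θ a b := by
  have h1 (i j : ι) : ContDiffOn ℝ 2 (fun θ ↦ (-(1 / 2) * Q i j) * (V θ)⁻¹ i j) Θ :=
    contDiffOn_const.mul (contDiffOn_inv_apply hV hdet i j)
  have h2 (i : ι) : ContDiffOn ℝ 2 (fun θ ↦ ∑ j, (-(1 / 2) * Q i j) * (V θ)⁻¹ i j) Θ :=
    ContDiffOn.sum fun j _ ↦ h1 i j
  simp only [limitContrast_eq_sum]
  have h3 (i j : ι) := congrFun₂ (hessian_const_mul (contDiffOn_inv_apply hV hdet i j) hΘ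
    (-(1 / 2) * Q i j) hθ) a b
  simp only [Matrix.smul_apply, smul_eq_mul] at h3
  simp only [← h3]
  simp only [hessian, Matrix.of_apply]
  rw [fun_iteratedFDerivWithin_add_apply ((ContDiffOn.sum fun i _ ↦ h2 i) θ hθ)
    (contDiffOn_log_det hV hdet θ hθ) hΘ hθ,
    iteratedFDerivWithin_fun_sum_apply hΘ hθ fun i _ ↦ h2 i θ hθ]
  simp only [iteratedFDerivWithin_fun_sum_apply hΘ hθ fun j _ ↦ h1 _ j θ hθ,
    _root_.add_apply, _root_.sum_apply]

lemma continuousOn_hessian_apply {f : E q → ℝ} (hf : ContDiffOn ℝ 2 f Θ) (hΘ : UniqueDiffOn ℝ Θ)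
    (a b : Fin q) : ContinuousOn (fun θ ↦ hessian f Θ θ a b) Θ := by
  have := hf.continuousOn_iteratedFDerivWithin (m := 2) le_rfl hΘ
  simp only [hessian, Matrix.of_apply]
  exact (ContinuousMultilinearMap.apply ℝ (fun _ : Fin 2 ↦ E q) ℝ
    ![EuclideanSpace.single a 1, EuclideanSpace.single b 1]).continuous.comp_continuousOn this

/-- Joint continuity is needed because the observed information has both a random matrix `Q` and a
random point `θ`. It follows from the affine dependence on `Q`. -/
lemma continuousOn_hessian_limitContrast (hΘ : UniqueDiffOn ℝ Θ)
    (hV : ∀ i j, ContDiffOn ℝ 2 (fun θ ↦ V θ i j) Θ) (hdet : ∀ θ ∈ Θ, (V θ).det ≠ 0) :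
    ContinuousOn (fun z : Matrix ι ι ℝ × E q ↦ hessian (fun θ ↦ limitContrast z.1 (V θ)) Θ z.2)
      (Set.univ ×ˢ Θ) := by
  have hm : Set.MapsTo (Prod.snd : Matrix ι ι ℝ × E q → E q) (Set.univ ×ˢ Θ) Θ := fun z hz ↦ hz.2
  refine continuousOn_pi.2 fun a ↦ continuousOn_pi.2 fun b ↦ ?_
  refine ContinuousOn.congr ?_ fun z hz ↦ hessian_limitContrast_apply hΘ hV hdet z.1 hz.2 a b
  refine ContinuousOn.add (continuousOn_finsetSum _ fun i _ ↦ continuousOn_finsetSum _ fun j _ ↦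
    ContinuousOn.mul (Continuous.continuousOn (by fun_prop)) ?_) ?_
  · exact (continuousOn_hessian_apply (contDiffOn_inv_apply hV hdet i j) hΘ a b).comp
      continuousOn_snd hm
  · exact (continuousOn_hessian_apply (contDiffOn_log_det hV hdet) hΘ a b).comp
      continuousOn_snd hm

end Hessian

/-- Stability of maximizers: if `F x₀` has the unique maximizer `y₀` on the compact set `K`, then
whatever holds near `(x₀, y₀)` holds at the maximizers of `F x`, for `x` near `x₀`. -/
lemma eventually_forall_isMaxOn {X Y : Type*} [TopologicalSpace X] [TopologicalSpace Y] [T1Space Y]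
    {F : X → Y → ℝ} {K : Set Y} (hK : IsCompact K)
    (hF : ContinuousOn (fun z : X × Y ↦ F z.1 z.2) (Set.univ ×ˢ K)) {x₀ : X} {y₀ : Y}
    (hy₀ : y₀ ∈ K) (huniq : ∀ y ∈ K, y ≠ y₀ → F x₀ y < F x₀ y₀) {p : X → Y → Prop}
    (hp : ∀ᶠ z : X × Y in 𝓝[Set.univ ×ˢ K] (x₀, y₀), p z.1 z.2) :
    ∀ᶠ x in 𝓝 x₀, ∀ y ∈ K, IsMaxOn (F x) K y → p x y := by
  -- By compactness of `K` it suffices to argue near each point `(x₀, y)`.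
  have := hK.eventually_forall_of_forall_eventually (x₀ := x₀)
    (P := fun x y ↦ y ∈ K → IsMaxOn (F x) K y → p x y) fun y hy ↦ ?_
  · exact this.mono fun x hx y hy ↦ hx y hy hy
  by_cases hyy : y = y₀
  · subst hyy
    rw [eventually_nhdsWithin_iff] at hp
    exact hp.mono fun z hz hz2 _ ↦ hz ⟨trivial, hz2⟩
  -- For `y ≠ y₀` the strict inequality `F x₀ y < F x₀ y₀` persists nearby, so no point there is a
  -- maximizer and the claim is vacuous.
  · have h1 : Tendsto (fun z : X × Y ↦ F z.1 z.2) (𝓝[Set.univ ×ˢ K] (x₀, y)) (𝓝 (F x₀ y)) :=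
      hF (x₀, y) ⟨trivial, hy⟩
    have hc : ContinuousOn (fun z : X × Y ↦ F z.1 y₀) (Set.univ ×ˢ K) :=
      hF.comp (f := fun z : X × Y ↦ (z.1, y₀)) (Continuous.continuousOn (by fun_prop))
        fun z _ ↦ ⟨trivial, hy₀⟩
    have h2 : Tendsto (fun z : X × Y ↦ F z.1 y₀) (𝓝[Set.univ ×ˢ K] (x₀, y)) (𝓝 (F x₀ y₀)) :=
      hc (x₀, y) ⟨trivial, hy⟩
    have h3 := h1.eventually_lt h2 (huniq y hy hyy)
    rw [eventually_nhdsWithin_iff] at h3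
    exact h3.mono fun z hz hz2 hmax ↦ absurd (hmax hy₀) (not_le.2 (hz ⟨trivial, hz2⟩))

/-! ### Deterministic comparison of the criteria -/

section Comparison

variable {q : ℕ} {Θ : Set (E q)} {ι : Type*} [Fintype ι] [DecidableEq ι]
variable {V : E q → Matrix ι ι ℝ} {V₀ : Matrix ι ι ℝ} {θbar : E q}

/-- Expansion of both criteria when the quasi-log likelihood is `n` times the contrast of a
matrix `Q` close to `V₀`. -/
lemma AssumptionC2.qbic_bounds (hC : AssumptionC2 Θ V V₀ θbar) (hΘ : UniqueDiffOn ℝ Θ)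
    (hcomp : IsCompact Θ) (hV : ∀ i j, ContDiffOn ℝ 2 (fun θ ↦ V θ i j) Θ)
    (hdet : ∀ θ ∈ Θ, (V θ).det ≠ 0) {e : ℝ} (he : 0 < e) :
    ∃ C : ℝ, ∀ᶠ Q in 𝓝 V₀, ∀ n : ℕ, 1 ≤ n → ∀ H : E q → ℝ,
      (∀ θ ∈ Θ, H θ = n * limitContrast Q (V θ)) → ∀ θ ∈ Θ, IsMaxOn H Θ θ →
      |qbic₁ H Θ n θ + 2 * n * limitContrast V₀ (V θbar)| ≤ 2 * n * e + q * Real.log n + C ∧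
      |qbic₂ H n θ + 2 * n * limitContrast V₀ (V θbar)| ≤ 2 * n * e + q * Real.log n + C := by
  set ℓ := limitContrast V₀ (V θbar) with hℓ
  set d := (-(hessian (fun θ ↦ limitContrast V₀ (V θ)) Θ θbar)).det with hd
  have hdpos : 0 < d := hC.posDef.det_pos
  have hF := continuousOn_limitContrast hV hdet
  have hG := continuousOn_hessian_limitContrast hΘ hV hdet
  have hz : (V₀, θbar) ∈ (Set.univ : Set (Matrix ι ι ℝ)) ×ˢ Θ := ⟨trivial, hC.mem⟩
  have hF0 : Tendsto (fun z : Matrix ι ι ℝ × E q ↦ limitContrast z.1 (V z.2))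
      (𝓝[Set.univ ×ˢ Θ] (V₀, θbar)) (𝓝 ℓ) := hF _ hz
  have hG0 : Tendsto (fun z : Matrix ι ι ℝ × E q ↦
      (-(hessian (fun θ ↦ limitContrast z.1 (V θ)) Θ z.2)).det)
      (𝓝[Set.univ ×ˢ Θ] (V₀, θbar)) (𝓝 d) := by
    have hc : Continuous fun A : Matrix (Fin q) (Fin q) ℝ ↦ (-A).det := by fun_prop
    exact (hc.tendsto _).comp (hG _ hz)
  have hnear : ∀ᶠ z : Matrix ι ι ℝ × E q in 𝓝[Set.univ ×ˢ Θ] (V₀, θbar),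
      |limitContrast z.1 (V z.2) - ℓ| < e ∧
      d / 2 < (-(hessian (fun θ ↦ limitContrast z.1 (V θ)) Θ z.2)).det ∧
      (-(hessian (fun θ ↦ limitContrast z.1 (V θ)) Θ z.2)).det < 2 * d := by
    refine ((Metric.tendsto_nhds.1 hF0 e he).mono fun z hz ↦ hz).and
      ((hG0.eventually_const_lt (by linarith)).and (hG0.eventually_lt_const (by linarith)))
  have hev := eventually_forall_isMaxOn (F := fun Q θ ↦ limitContrast Q (V θ)) hcomp hF hC.mem
    (fun θ hθ hne ↦ lt_of_le_of_ne (hC.isMax θ hθ) fun h ↦ hne (hC.unique θ hθ h))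
    (p := fun Q θ ↦ |limitContrast Q (V θ) - ℓ| < e ∧
      d / 2 < (-(hessian (fun θ ↦ limitContrast Q (V θ)) Θ θ)).det ∧
      (-(hessian (fun θ ↦ limitContrast Q (V θ)) Θ θ)).det < 2 * d) hnear
  -- The neighbourhood of `V₀` is fixed before `n` and `H`. This constant bounds `|log det|` of the
  -- information matrix, whose determinant is kept in `(d / 2, 2 * d)`.
  refine ⟨|Real.log (d / 2)| + |Real.log (2 * d)|, hev.mono fun Q hQ n hn H hH θ hθ hmax ↦ ?_⟩
  have hn0 : (0 : ℝ) < n := by exact_mod_cast hn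
  have hmax' : IsMaxOn (fun θ ↦ limitContrast Q (V θ)) Θ θ := fun x hx ↦ by
    have h1 : H x ≤ H θ := hmax hx
    rw [hH x hx, hH θ hθ] at h1
    exact le_of_mul_le_mul_left h1 hn0
  obtain ⟨h1, h2, h3⟩ := hQ θ hθ hmax'
  have hhess : -((n : ℝ)⁻¹ • hessian H Θ θ)
      = -(hessian (fun θ ↦ limitContrast Q (V θ)) Θ θ) := by
    rw [hessian_congr (g := fun θ ↦ n * limitContrast Q (V θ)) hH hθ,
      hessian_const_mul (contDiffOn_limitContrast hV hdet Q) hΘ _ hθ, smul_smul,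
      inv_mul_cancel₀ hn0.ne', one_smul]
  -- Positive definiteness of the information matrix need not be proved: in the default branch the
  -- identity has log-determinant `0`, within the same bound.
  have hlog : |Real.log (gammaTilde H Θ n θ).det| ≤ |Real.log (d / 2)| + |Real.log (2 * d)|
      ∧ 0 < (gammaTilde H Θ n θ).det := by
    simp only [gammaTilde, hhess]
    split_ifs
    · have hpos : 0 < (-(hessian (fun θ ↦ limitContrast Q (V θ)) Θ θ)).det := by linarith
      have ha := Real.log_lt_log (by linarith) h2
      have hb := Real.log_lt_log hpos h3
      refine ⟨abs_le.2 ⟨?_, ?_⟩, hpos⟩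
      · linarith [neg_abs_le (Real.log (d / 2)), abs_nonneg (Real.log (2 * d))]
      · linarith [le_abs_self (Real.log (2 * d)), abs_nonneg (Real.log (d / 2))]
    · simp only [Matrix.det_one, Real.log_one, abs_zero]
      exact ⟨by positivity, one_pos⟩
  have hlogn : 0 ≤ Real.log n := Real.log_nonneg (by exact_mod_cast hn)
  have hqn : 0 ≤ (q : ℝ) * Real.log n := by positivity
  have hmain : |(-2 * H θ) + 2 * n * ℓ| ≤ 2 * n * e := by
    rw [hH θ hθ]
    have : -2 * (n * limitContrast Q (V θ)) + 2 * n * ℓ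
        = -(2 * n) * (limitContrast Q (V θ) - ℓ) := by ring
    rw [this, abs_mul, abs_neg, abs_of_pos (by positivity : (0 : ℝ) < 2 * n)]
    exact mul_le_mul_of_nonneg_left h1.le (by positivity)
  have hdetn : Real.log ((n : ℝ) • gammaTilde H Θ n θ).det
      = q * Real.log n + Real.log (gammaTilde H Θ n θ).det := by
    rw [Matrix.det_smul, Fintype.card_fin, Real.log_mul (by positivity) hlog.2.ne', Real.log_pow]
  have hm := abs_le.1 hmain
  have hl := abs_le.1 hlog.1
  constructor
  · rw [qbic₁, hdetn]
    exact abs_le.2 ⟨by linarith, by linarith⟩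
  · have := abs_nonneg (Real.log (d / 2))
    have := abs_nonneg (Real.log (2 * d))
    rw [qbic₂]
    exact abs_le.2 ⟨by linarith, by linarith⟩

/-- A model whose optimal limit contrast is larger has, eventually, smaller criteria. -/
lemma eventually_qbic_lt {q' : ℕ} {Θ' : Set (E q')} {V' : E q' → Matrix ι ι ℝ} {θbar' : E q'}
    (hC : AssumptionC2 Θ V V₀ θbar) (hΘ : UniqueDiffOn ℝ Θ)
    (hcomp : IsCompact Θ) (hV : ∀ i j, ContDiffOn ℝ 2 (fun θ ↦ V θ i j) Θ)
    (hdet : ∀ θ ∈ Θ, (V θ).det ≠ 0)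
    (hC' : AssumptionC2 Θ' V' V₀ θbar') (hΘ' : UniqueDiffOn ℝ Θ')
    (hcomp' : IsCompact Θ') (hV' : ∀ i j, ContDiffOn ℝ 2 (fun θ ↦ V' θ i j) Θ')
    (hdet' : ∀ θ ∈ Θ', (V' θ).det ≠ 0)
    (hlt : limitContrast V₀ (V' θbar') < limitContrast V₀ (V θbar)) :
    ∃ N : ℕ, ∀ᶠ Q in 𝓝 V₀, ∀ n ≥ N, ∀ (H : E q → ℝ) (H' : E q' → ℝ),
      (∀ θ ∈ Θ, H θ = n * limitContrast Q (V θ)) →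
      (∀ θ ∈ Θ', H' θ = n * limitContrast Q (V' θ)) →
      ∀ θ ∈ Θ, IsMaxOn H Θ θ → ∀ θ' ∈ Θ', IsMaxOn H' Θ' θ' →
      qbic₁ H Θ n θ < qbic₁ H' Θ' n θ' ∧ qbic₂ H n θ < qbic₂ H' n θ' := by
  set g := limitContrast V₀ (V θbar) - limitContrast V₀ (V' θbar') with hg
  have hgpos : 0 < g := sub_pos.2 hlt
  -- With `e = g / 4` the two errors of order `n` add up to `n * g`, half of the gap `2 * n * g`.
  -- The other half absorbs the logarithms and constants for large `n`.
  obtain ⟨C, hQ⟩ := hC.qbic_bounds hΘ hcomp hV hdet (e := g / 4) (by linarith)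
  obtain ⟨C', hQ'⟩ := hC'.qbic_bounds hΘ' hcomp' hV' hdet' (e := g / 4) (by linarith)
  have hlim : Tendsto (fun n : ℕ ↦ (n : ℝ)⁻¹ * ((q + q') * Real.log n + (C + C'))) atTop (𝓝 0) := by
    have h1 : Tendsto (fun n : ℕ ↦ Real.log n / n) atTop (𝓝 0) :=
      (Real.isLittleO_log_id_atTop.tendsto_div_nhds_zero).comp tendsto_natCast_atTop_atTop
    have h2 : Tendsto (fun n : ℕ ↦ (n : ℝ)⁻¹) atTop (𝓝 0) := tendsto_inv_atTop_nhds_zero_nat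
    have h3 := (h1.const_mul ((q : ℝ) + q')).add (h2.mul_const (C + C'))
    simp only [mul_zero, zero_mul, add_zero] at h3
    exact h3.congr fun n ↦ by ring
  obtain ⟨N, hN⟩ := eventually_atTop.1 (hlim.eventually_lt_const hgpos)
  refine ⟨max N 1, (hQ.and hQ').mono fun Q hQ n hn H H' hH hH' θ hθ hmax θ' hθ' hmax' ↦ ?_⟩
  have hn1 : 1 ≤ n := le_trans (le_max_right _ _) hn
  have hn0 : (0 : ℝ) < n := by exact_mod_cast hn1
  have hsmall := hN n (le_trans (le_max_left _ _) hn)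
  rw [inv_mul_lt_iff₀ hn0, hg] at hsmall
  obtain ⟨a1, a2⟩ := hQ.1 n hn1 H hH θ hθ hmax
  obtain ⟨b1, b2⟩ := hQ.2 n hn1 H' hH' θ' hθ' hmax'
  rw [abs_le, hg] at a1 a2 b1 b2
  constructor
  · nlinarith [a1.2, b1.1]
  · nlinarith [a2.2, b2.1]

end Comparison

/-! ### Realized covariation of Brownian motions -/

section RealizedCovariation

variable {Ω : Type*} {mΩ : MeasurableSpace Ω} {P : Measure Ω}

/-- The increment of `B` over the `i`-th time step of length `h`. -/
def stepIncr (B : ℝ≥0 → Ω → ℝ) (h : ℝ≥0) (i : ℕ) (ω : Ω) : ℝ :=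
  B (((i + 1 : ℕ) : ℝ≥0) * h) ω - B ((i : ℝ≥0) * h) ω

/-- A weak law of large numbers for triangular arrays of uncorrelated variables. -/
lemma tendsto_measure_abs_sum_sub_ge [IsProbabilityMeasure P] {Y : ℕ → ℕ → Ω → ℝ} {c C : ℝ}
    (hY : ∀ n i, MemLp (Y n i) 2 P) (hmean : ∀ n i : ℕ, P[Y n i] = c / n)
    (hvar : ∀ n i : ℕ, Var[Y n i; P] ≤ C / n ^ 2) (hcov : ∀ n i j, i ≠ j → cov[Y n i, Y n j; P] = 0)
    {e : ℝ} (he : 0 < e) :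
    Tendsto (fun n : ℕ ↦ P {ω | e ≤ |(∑ i ∈ Finset.range n, Y n i ω) - c|}) atTop (𝓝 0) := by
  -- Chebyshev: since the covariances vanish, the variance of the sum is at most `n * (C / n ^ 2)`.
  have hbound : ∀ᶠ n : ℕ in atTop, P {ω | e ≤ |(∑ i ∈ Finset.range n, Y n i ω) - c|}
      ≤ ENNReal.ofReal (C / n / e ^ 2) := by
    filter_upwards [eventually_ge_atTop 1] with n hn
    have hn0 : (0 : ℝ) < n := by exact_mod_cast hn
    have hL : MemLp (fun ω ↦ ∑ i ∈ Finset.range n, Y n i ω) 2 P :=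
      memLp_finsetSum _ fun i _ ↦ hY n i
    have hm : P[fun ω ↦ ∑ i ∈ Finset.range n, Y n i ω] = c := by
      rw [integral_finsetSum _ fun i _ ↦ (hY n i).integrable (by norm_num)]
      simp only [hmean, Finset.sum_const, Finset.card_range, nsmul_eq_mul]
      field_simp
    have hv : Var[fun ω ↦ ∑ i ∈ Finset.range n, Y n i ω; P] ≤ C / n := by
      rw [variance_fun_sum' fun i _ ↦ hY n i]
      calc ∑ i ∈ Finset.range n, ∑ j ∈ Finset.range n, cov[Y n i, Y n j; P]
          = ∑ i ∈ Finset.range n, Var[Y n i; P] := by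
            refine Finset.sum_congr rfl fun i hi ↦ ?_
            rw [Finset.sum_eq_single i (fun j _ hj ↦ hcov n i j hj.symm) fun h ↦ absurd hi h,
              covariance_self (hY n i).aemeasurable]
        _ ≤ ∑ i ∈ Finset.range n, C / n ^ 2 := Finset.sum_le_sum fun i _ ↦ hvar n i
        _ = C / n := by
            simp only [Finset.sum_const, Finset.card_range, nsmul_eq_mul]
            field_simp
    have := meas_ge_le_variance_div_sq hL he
    rw [hm] at this
    exact this.trans (ENNReal.ofReal_le_ofReal (by gcongr))
  have hlim : Tendsto (fun n : ℕ ↦ ENNReal.ofReal (C / n / e ^ 2)) atTop (𝓝 0) := by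
    rw [← ENNReal.ofReal_zero]
    refine ENNReal.tendsto_ofReal ?_
    have := (tendsto_const_div_atTop_nhds_zero_nat C).div_const (e ^ 2)
    rwa [zero_div] at this
  exact tendsto_of_tendsto_of_tendsto_of_le_of_le' tendsto_const_nhds hlim
    (Eventually.of_forall fun _ ↦ zero_le) hbound

variable {B B' : ℝ≥0 → Ω → ℝ}

lemma hasLaw_stepIncr (hB : IsPreBrownianReal B P) (h : ℝ≥0) (i : ℕ) :
    HasLaw (stepIncr B h i) (gaussianReal 0 h) P := by
  have := hB.hasLaw_sub (((i + 1 : ℕ) : ℝ≥0) * h) ((i : ℝ≥0) * h)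
  have hdist : h = nndist (((i + 1 : ℕ) : ℝ≥0) * h).1 ((i : ℝ≥0) * h).1 := by
    ext
    simp only [coe_nndist, Real.dist_eq, NNReal.val_eq_coe, NNReal.coe_mul, NNReal.coe_natCast]
    push_cast
    rw [← sub_mul, add_sub_cancel_left, one_mul, abs_of_nonneg (NNReal.coe_nonneg h)]
  rw [← hdist] at this
  exact this

lemma memLp_stepIncr (hB : IsPreBrownianReal B P) (h : ℝ≥0) (i : ℕ) {p : ℝ≥0∞} (hp : p ≠ ∞) :
    MemLp (stepIncr B h i) p P :=
  (hasLaw_stepIncr hB h i).hasGaussianLaw.memLp hp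

lemma integral_stepIncr (hB : IsPreBrownianReal B P) (h : ℝ≥0) (i : ℕ) :
    P[stepIncr B h i] = 0 := by
  rw [(hasLaw_stepIncr hB h i).integral_eq, integral_id_gaussianReal]

lemma indepFun_stepIncr (hB : IsPreBrownianReal B P) (h : ℝ≥0) {i j : ℕ} (hij : i ≠ j) :
    stepIncr B h i ⟂ᵢ[P] stepIncr B h j := by
  have hmono : Monotone fun i : ℕ ↦ (i : ℝ≥0) * h := fun a b hab ↦ by
    dsimp only
    gcongr
  exact (hB.hasIndepIncrements.nat hmono).indepFun hij

lemma integral_stepIncr_mul [IsProbabilityMeasure P] (hB : IsPreBrownianReal B P) (h : ℝ≥0)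
    {i j : ℕ} (hij : i ≠ j) :
    ∫ ω, stepIncr B h i ω * stepIncr B h j ω ∂P = 0 := by
  rw [(indepFun_stepIncr hB h hij).integral_fun_mul_eq_mul_integral
    (memLp_stepIncr hB h i (p := 2) (by simp)).aestronglyMeasurable
    (memLp_stepIncr hB h j (p := 2) (by simp)).aestronglyMeasurable, integral_stepIncr hB, zero_mul]

lemma integral_stepIncr_sq [IsProbabilityMeasure P] (hB : IsPreBrownianReal B P) (h : ℝ≥0)
    (i : ℕ) : ∫ ω, stepIncr B h i ω ^ 2 ∂P = h := by
  have h1 := variance_eq_sub (memLp_stepIncr hB h i (p := 2) (by simp))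
  rw [(hasLaw_stepIncr hB h i).variance_eq, variance_id_gaussianReal, integral_stepIncr hB] at h1
  simpa using h1.symm

/-- Hölder's inequality with exponents `4, 4, 2`, as Gaussian variables have fourth moments. -/
lemma memLp_stepIncr_mul (hB : IsPreBrownianReal B P) (hB' : IsPreBrownianReal B' P) (h : ℝ≥0)
    (i j : ℕ) : MemLp (fun ω ↦ stepIncr B h i ω * stepIncr B' h j ω) 2 P := by
  have : ENNReal.HolderTriple 4 4 2 := ⟨by
    rw [← two_mul, show (4 : ℝ≥0∞) = 2 * 2 by norm_num, ENNReal.mul_inv (by simp) (by simp),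
      ← mul_assoc, ENNReal.mul_inv_cancel (by simp) (by simp), one_mul]⟩
  exact (memLp_stepIncr hB' h j (p := 4) (by simp)).mul (memLp_stepIncr hB h i (p := 4) (by simp))

/-- Brownian scaling: an increment is distributed as `√h` times a standard Gaussian. The variance of
the squared Gaussian is never computed; only its independence of `h` matters. -/
lemma variance_stepIncr_sq (hB : IsPreBrownianReal B P) (h : ℝ≥0) (i : ℕ) :
    Var[fun ω ↦ stepIncr B h i ω * stepIncr B h i ω; P]
      = (h : ℝ) ^ 2 * Var[fun x ↦ x * x; gaussianReal 0 1] := by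
  have hm : (gaussianReal 0 1).map (√(h : ℝ) * ·) = gaussianReal 0 h := by
    rw [gaussianReal_map_const_mul]
    congr 1
    · simp
    · ext; simp
  have h1 := (hasLaw_stepIncr hB h i)
  rw [← hm] at h1
  have h2 : Var[(fun x ↦ x * x) ∘ stepIncr B h i; P] = Var[fun x ↦ x * x; P.map (stepIncr B h i)] :=
    (variance_map (by fun_prop) h1.aemeasurable).symm
  change Var[(fun x ↦ x * x) ∘ stepIncr B h i; P] = _
  rw [h2, h1.map_eq, variance_map (by fun_prop) (by fun_prop), ← variance_const_mul]
  congr 1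
  ext x
  simp only [Function.comp_apply]
  rw [mul_mul_mul_comm, Real.mul_self_sqrt (NNReal.coe_nonneg h)]

lemma tendsto_realized_variance [IsProbabilityMeasure P] (hB : IsPreBrownianReal B P) (T : ℝ≥0)
    {e : ℝ} (he : 0 < e) :
    Tendsto (fun n : ℕ ↦ P {ω | e ≤ |(∑ i ∈ Finset.range n,
      stepIncr B (T / n) i ω * stepIncr B (T / n) i ω) - T|}) atTop (𝓝 0) := by
  refine tendsto_measure_abs_sum_sub_ge (Y := fun n i ω ↦
      stepIncr B (T / n) i ω * stepIncr B (T / n) i ω)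
    (C := (T : ℝ) ^ 2 * Var[fun x ↦ x * x; gaussianReal 0 1])
    (fun n i ↦ memLp_stepIncr_mul hB hB _ i i) (fun n i ↦ ?_) (fun n i ↦ ?_)
    (fun n i j hij ↦ ?_) he
  · simp only [← pow_two]
    rw [integral_stepIncr_sq hB]
    simp
  · rw [variance_stepIncr_sq hB]
    refine le_of_eq ?_
    push_cast
    ring
  · exact ((indepFun_stepIncr hB (T / n) hij).comp (φ := fun x ↦ x * x) (ψ := fun x ↦ x * x)
      (by fun_prop) (by fun_prop)).covariance_eq_zero (memLp_stepIncr_mul hB hB _ i i)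
      (memLp_stepIncr_mul hB hB _ j j)

/-- Regrouping the factors by process makes independence of the two paths applicable. The case `i =
j` gives the variance of a product of increments, the case `i ≠ j` the vanishing covariances. -/
lemma integral_mul_mul_stepIncr (hB : IsPreBrownianReal B P)
    (hB' : IsPreBrownianReal B' P) (hind : (fun ω t ↦ B t ω) ⟂ᵢ[P] (fun ω t ↦ B' t ω)) (h : ℝ≥0)
    (i j : ℕ) :
    ∫ ω, (stepIncr B h i ω * stepIncr B' h i ω) * (stepIncr B h j ω * stepIncr B' h j ω) ∂P
      = (∫ ω, stepIncr B h i ω * stepIncr B h j ω ∂P)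
        * ∫ ω, stepIncr B' h i ω * stepIncr B' h j ω ∂P := by
  set φ : (ℝ≥0 → ℝ) → ℝ := fun x ↦ (x (((i + 1 : ℕ) : ℝ≥0) * h) - x ((i : ℝ≥0) * h))
    * (x (((j + 1 : ℕ) : ℝ≥0) * h) - x ((j : ℝ≥0) * h)) with hφ
  have hφm : Measurable φ := by fun_prop
  refine Eq.trans ?_ ((hind.comp hφm hφm).integral_fun_mul_eq_mul_integral
    (memLp_stepIncr_mul hB hB h i j).aestronglyMeasurable
    (memLp_stepIncr_mul hB' hB' h i j).aestronglyMeasurable)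
  refine integral_congr_ae (Eventually.of_forall fun ω ↦ ?_)
  simp only [hφ, Function.comp_apply, stepIncr]
  ring

lemma integral_mul_stepIncr [IsProbabilityMeasure P] (hB : IsPreBrownianReal B P)
    (hB' : IsPreBrownianReal B' P) (hind : (fun ω t ↦ B t ω) ⟂ᵢ[P] (fun ω t ↦ B' t ω)) (h : ℝ≥0)
    (i : ℕ) : ∫ ω, stepIncr B h i ω * stepIncr B' h i ω ∂P = 0 := by
  set φ : (ℝ≥0 → ℝ) → ℝ := fun x ↦ x (((i + 1 : ℕ) : ℝ≥0) * h) - x ((i : ℝ≥0) * h) with hφ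
  have hφm : Measurable φ := by fun_prop
  have := (hind.comp hφm hφm).integral_fun_mul_eq_mul_integral
    (memLp_stepIncr hB h i (p := 2) (by simp)).aestronglyMeasurable
    (memLp_stepIncr hB' h i (p := 2) (by simp)).aestronglyMeasurable
  refine this.trans ?_
  rw [show φ ∘ (fun ω t ↦ B t ω) = stepIncr B h i from rfl, integral_stepIncr hB, zero_mul]

lemma tendsto_realized_covariance [IsProbabilityMeasure P] (hB : IsPreBrownianReal B P)
    (hB' : IsPreBrownianReal B' P) (hind : (fun ω t ↦ B t ω) ⟂ᵢ[P] (fun ω t ↦ B' t ω)) (T : ℝ≥0)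
    {e : ℝ} (he : 0 < e) :
    Tendsto (fun n : ℕ ↦ P {ω | e ≤ |∑ i ∈ Finset.range n,
      stepIncr B (T / n) i ω * stepIncr B' (T / n) i ω|}) atTop (𝓝 0) := by
  have hL (n i : ℕ) := memLp_stepIncr_mul hB hB' (T / n) i i
  have := tendsto_measure_abs_sum_sub_ge (Y := fun n i ω ↦
      stepIncr B (T / n) i ω * stepIncr B' (T / n) i ω) (c := 0)
    (C := (T : ℝ) ^ 2) hL (fun n i ↦ ?_) (fun n i ↦ ?_) (fun n i j hij ↦ ?_) he
  · simpa only [sub_zero] using this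
  · rw [integral_mul_stepIncr hB hB' hind]; simp
  · rw [variance_eq_sub (hL n i), integral_mul_stepIncr hB hB' hind]
    simp only [Pi.pow_apply]
    simp only [pow_two]
    rw [integral_mul_mul_stepIncr hB hB' hind]
    simp only [← pow_two]
    rw [integral_stepIncr_sq hB, integral_stepIncr_sq hB']
    refine le_of_eq ?_
    push_cast
    ring
  · rw [covariance_eq_sub (hL n i) (hL n j), integral_mul_stepIncr hB hB' hind, zero_mul, sub_zero]
    simp only [Pi.mul_apply]
    rw [integral_mul_mul_stepIncr hB hB' hind, integral_stepIncr_mul hB _ hij, zero_mul]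

end RealizedCovariation

/-! ### The quasi-log likelihood as a contrast -/

section Likelihood

variable {ι : Type*} [Fintype ι] [DecidableEq ι]

/-- The realized covariance per unit of time of `n` increments over `[0, T]`. -/
noncomputable def realizedCov (T : ℝ) (n : ℕ) (Δ : ℕ → ι → ℝ) : Matrix ι ι ℝ :=
  T⁻¹ • ∑ i ∈ Finset.range n, Matrix.vecMulVec (Δ i) (Δ i)

lemma quasiLik_pos {V : Matrix ι ι ℝ} (hV : 0 < V.det) {h : ℝ} (hh : 0 < h) (n : ℕ)
    (Δ : ℕ → ι → ℝ) : 0 < quasiLik V h n Δ := by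
  unfold quasiLik
  exact Finset.prod_pos fun i _ ↦ by positivity

/-- An exact identity: the powers of `2πh` cancel, and `1 / (2h) = n / (2T)` turns the sum of
quadratic forms into `n / 2` times the bracket with the realized covariance. -/
lemma quasiLogLik_eq {V : Matrix ι ι ℝ} (hV : 0 < V.det) {T : ℝ} (hT : 0 < T) {n : ℕ}
    (hn : 1 ≤ n) (Δ : ℕ → ι → ℝ) :
    quasiLogLik V (T / n) n Δ = n * limitContrast (realizedCov T n Δ) V := by
  have hn0 : (0 : ℝ) < n := by exact_mod_cast hn
  have hh : 0 < T / n := by positivity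
  have hb : bracket V⁻¹ (realizedCov T n Δ)
      = T⁻¹ * ∑ i ∈ Finset.range n, bracket V⁻¹ (Matrix.vecMulVec (Δ i) (Δ i)) := by
    simp only [bracket, realizedCov, Matrix.transpose_smul, Matrix.transpose_sum, Matrix.mul_smul,
      Matrix.trace_smul, Matrix.mul_sum, Matrix.trace_sum, smul_eq_mul]
  have hL := quasiLik_pos hV hh n Δ
  rw [quasiLogLik, Real.log_mul (by positivity) hL.ne', Real.log_rpow (by positivity), quasiLik,
    Real.log_prod fun i _ ↦ by positivity]
  have hterm (i : ℕ) : Real.log (1 / ((2 * Real.pi * (T / n)) ^ ((Fintype.card ι : ℝ) / 2)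
        * V.det ^ ((1 : ℝ) / 2))
      * Real.exp (-(1 / (2 * (T / n))) * bracket V⁻¹ (Matrix.vecMulVec (Δ i) (Δ i))))
      = -((Fintype.card ι : ℝ) / 2 * Real.log (2 * Real.pi * (T / n)) + 1 / 2 * Real.log V.det)
        + -(1 / (2 * (T / n))) * bracket V⁻¹ (Matrix.vecMulVec (Δ i) (Δ i)) := by
    rw [Real.log_mul (by positivity) (by positivity), Real.log_exp, one_div, Real.log_inv,
      Real.log_mul (by positivity) (by positivity), Real.log_rpow (by positivity),
      Real.log_rpow hV]
  simp only [hterm]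
  rw [Finset.sum_add_distrib, ← Finset.mul_sum, Finset.sum_const, Finset.card_range, nsmul_eq_mul,
    limitContrast, hb]
  field_simp
  ring

lemma isMaxOn_quasiLogLik {F : Type*} {s : Set F} {V : F → Matrix ι ι ℝ}
    (hV : ∀ x ∈ s, 0 < (V x).det) {h : ℝ} (hh : 0 < h) (n : ℕ) (Δ : ℕ → ι → ℝ) {x₀ : F}
    (hmax : IsMaxOn (fun x ↦ quasiLik (V x) h n Δ) s x₀) :
    IsMaxOn (fun x ↦ quasiLogLik (V x) h n Δ) s x₀ := fun x hx ↦ by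
  have h1 : quasiLik (V x) h n Δ ≤ quasiLik (V x₀) h n Δ := hmax hx
  exact Real.log_le_log (mul_pos (by positivity) (quasiLik_pos (hV x hx) hh n Δ))
    (mul_le_mul_of_nonneg_left h1 (by positivity))

end Likelihood

/-! ### Negligibility of Lipschitz parts in quadratic sums -/

section Lipschitz

/-- `f` is Lipschitz continuous on `[0, T]`. -/
def LipOn (T : ℝ≥0) (f : ℝ≥0 → ℝ) : Prop :=
  ∃ K : ℝ, ∀ s ≤ T, ∀ t ≤ T, |f t - f s| ≤ K * |(t : ℝ) - s|

variable {T : ℝ≥0} {f g : ℝ≥0 → ℝ}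

lemma LipOn.const (c : ℝ) : LipOn T fun _ ↦ c := ⟨0, fun s _ t _ ↦ by simp⟩

lemma LipOn.add (hf : LipOn T f) (hg : LipOn T g) : LipOn T fun t ↦ f t + g t := by
  obtain ⟨K, hK⟩ := hf
  obtain ⟨L, hL⟩ := hg
  refine ⟨K + L, fun s hs t ht ↦ ?_⟩
  rw [add_sub_add_comm, add_mul]
  exact (abs_add_le _ _).trans (add_le_add (hK s hs t ht) (hL s hs t ht))

lemma LipOn.const_mul (hf : LipOn T f) (c : ℝ) : LipOn T fun t ↦ c * f t := by
  obtain ⟨K, hK⟩ := hf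
  refine ⟨|c| * K, fun s hs t ht ↦ ?_⟩
  rw [← mul_sub, abs_mul, mul_assoc]
  exact mul_le_mul_of_nonneg_left (hK s hs t ht) (abs_nonneg c)

lemma LipOn.sum {κ : Type*} {s : Finset κ} {f : κ → ℝ≥0 → ℝ} (hf : ∀ i, LipOn T (f i)) :
    LipOn T fun t ↦ ∑ i ∈ s, f i t := by
  classical
  induction s using Finset.induction_on with
  | empty => simpa using LipOn.const 0
  | insert a s ha ih => simpa only [Finset.sum_insert ha] using (hf a).add ih

lemma LipOn.mulVec {κ κ' : Type*} [Fintype κ'] (A : Matrix κ κ' ℝ) {f : ℝ≥0 → κ' → ℝ}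
    (hf : ∀ j, LipOn T fun t ↦ f t j) (i : κ) : LipOn T fun t ↦ (A *ᵥ f t) i := by
  simp only [Matrix.mulVec, dotProduct]
  exact LipOn.sum fun j ↦ (hf j).const_mul _

lemma LipOn.continuousOn (hf : LipOn T f) : ContinuousOn f (Set.Iic T) := by
  obtain ⟨K, hK⟩ := hf
  have : LipschitzOnWith K.toNNReal f (Set.Iic T) := LipschitzOnWith.of_dist_le_mul
    fun s hs t ht ↦ by
      rw [Real.dist_eq, NNReal.dist_eq]
      exact (hK t ht s hs).trans (mul_le_mul_of_nonneg_right (Real.le_coe_toNNReal K)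
        (abs_nonneg _))
  exact this.continuousOn

lemma LipOn.integral {u : ℝ → ℝ} (hu : Continuous u) :
    LipOn T fun t ↦ ∫ s in (0 : ℝ)..(t : ℝ), u s := by
  obtain ⟨K, hK⟩ := (isCompact_Icc (a := (0 : ℝ)) (b := T)).exists_bound_of_continuousOn
    hu.continuousOn
  refine ⟨K, fun s hs t ht ↦ ?_⟩
  rw [intervalIntegral.integral_interval_sub_left (hu.intervalIntegrable _ _)
    (hu.intervalIntegrable _ _), ← Real.norm_eq_abs]
  refine intervalIntegral.norm_integral_le_of_norm_le_const fun x hx ↦ hK x ?_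
  have h1 := (Set.uIoc_subset_uIcc hx)
  have h2 : Set.uIcc (s : ℝ) t ⊆ Set.Icc 0 T :=
    Set.uIcc_subset_Icc ⟨s.2, NNReal.coe_le_coe.2 hs⟩ ⟨t.2, NNReal.coe_le_coe.2 ht⟩
  exact h2 h1

/-- Each increment of `g` is at most `|K| * T / n`, while those of `f` are uniformly small by
uniform continuity on `[0, T]`; `n` such products sum to `o(1)`. -/
lemma tendsto_sum_incr_mul_incr (hf : ContinuousOn f (Set.Iic T)) (hg : LipOn T g) :
    Tendsto (fun n : ℕ ↦ ∑ i ∈ Finset.range n,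
      (f (((i + 1 : ℕ) : ℝ≥0) * (T / n)) - f ((i : ℝ≥0) * (T / n)))
        * (g (((i + 1 : ℕ) : ℝ≥0) * (T / n)) - g ((i : ℝ≥0) * (T / n)))) atTop (𝓝 0) := by
  obtain ⟨K, hK⟩ := hg
  have hcomp : IsCompact (Set.Iic T) := by
    rw [← Set.Icc_bot]
    exact isCompact_Icc
  have huc := Metric.uniformContinuousOn_iff.1 (hcomp.uniformContinuousOn_of_continuous hf)
  rw [Metric.tendsto_atTop]
  intro e he
  -- The sum will be at most `e * (|K| * T / (|K| * T + 1))`. The `+ 1` makes this strictly less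
  -- than `e` and keeps the denominator positive.
  obtain ⟨d, hd, hfd⟩ := huc (e / (|K| * T + 1)) (by positivity)
  have hstep : Tendsto (fun n : ℕ ↦ (T : ℝ) / n) atTop (𝓝 0) := tendsto_const_div_atTop_nhds_zero_nat _
  obtain ⟨N, hN⟩ := eventually_atTop.1 (hstep.eventually_lt_const hd)
  refine ⟨max N 1, fun n hn ↦ ?_⟩
  have hn0 : (0 : ℝ) < n := by exact_mod_cast le_trans (le_max_right N 1) hn
  have hTn := hN n (le_trans (le_max_left _ _) hn)
  have hmem (i : ℕ) (hi : i ≤ n) : (i : ℝ≥0) * (T / n) ≤ T := by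
    have hn1 : (0 : ℝ≥0) < n := by exact_mod_cast hn0
    rw [mul_div_left_comm]
    refine mul_le_of_le_one_right zero_le ?_
    rw [div_le_one hn1]
    exact_mod_cast hi
  have hdiff (i : ℕ) : |(((((i + 1 : ℕ) : ℝ≥0) * (T / n) : ℝ≥0)) : ℝ)
      - (((i : ℝ≥0) * (T / n) : ℝ≥0) : ℝ)| = T / n := by
    push_cast
    rw [← sub_mul, add_sub_cancel_left, one_mul, abs_of_nonneg (by positivity)]
  rw [Real.dist_eq, sub_zero]
  calc _ ≤ ∑ i ∈ Finset.range n, (e / (|K| * T + 1)) * (|K| * (T / n)) := by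
        refine (Finset.abs_sum_le_sum_abs _ _).trans (Finset.sum_le_sum fun i hi ↦ ?_)
        have hi' := Finset.mem_range.1 hi
        rw [abs_mul]
        refine mul_le_mul ?_ ?_ (abs_nonneg _) (by positivity)
        · refine (hfd _ (hmem (i + 1) hi') _ (hmem i hi'.le) ?_).le
          rw [NNReal.dist_eq, hdiff]
          exact hTn
        · refine (hK _ (hmem i hi'.le) _ (hmem (i + 1) hi')).trans ?_
          rw [hdiff]
          exact mul_le_mul_of_nonneg_right (le_abs_self K) (by positivity)
    _ = e * (|K| * T / (|K| * T + 1)) := by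
        simp only [Finset.sum_const, Finset.card_range, nsmul_eq_mul]
        field_simp
    _ < e * 1 := by
        refine mul_lt_mul_of_pos_left ?_ he
        rw [div_lt_one (by positivity)]
        linarith
    _ = e := mul_one e

end Lipschitz

/-! ### Convergence to zero in probability -/

section Probability

variable {Ω : Type*} {mΩ : MeasurableSpace Ω} {P : Measure Ω}

lemma tendstoInMeasure_zero_iff {f : ℕ → Ω → ℝ} : TendstoInMeasure P f atTop (fun _ ↦ (0 : ℝ)) ↔
    ∀ e : ℝ, 0 < e → Tendsto (fun n ↦ P {ω | e ≤ |f n ω|}) atTop (𝓝 0) := by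
  simp only [tendstoInMeasure_iff_norm, sub_zero, Real.norm_eq_abs]

lemma tendstoInMeasure_zero_add {f g : ℕ → Ω → ℝ}
    (hf : TendstoInMeasure P f atTop fun _ ↦ (0 : ℝ))
    (hg : TendstoInMeasure P g atTop fun _ ↦ (0 : ℝ)) :
    TendstoInMeasure P (fun n ω ↦ f n ω + g n ω) atTop fun _ ↦ (0 : ℝ) := by
  rw [tendstoInMeasure_zero_iff] at *
  intro e he
  have h := (hf (e / 2) (by positivity)).add (hg (e / 2) (by positivity))
  rw [add_zero] at h
  refine tendsto_of_tendsto_of_tendsto_of_le_of_le tendsto_const_nhds h (fun _ ↦ zero_le)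
    fun n ↦ (measure_mono fun ω hω ↦ ?_).trans (measure_union_le _ _)
  by_contra hcon
  simp only [Set.mem_union, Set.mem_ofPred_eq, not_or, not_le] at hcon hω
  linarith [abs_add_le (f n ω) (g n ω), hcon.1, hcon.2]

lemma tendstoInMeasure_zero_const_mul {f : ℕ → Ω → ℝ}
    (hf : TendstoInMeasure P f atTop fun _ ↦ (0 : ℝ)) (c : ℝ) :
    TendstoInMeasure P (fun n ω ↦ c * f n ω) atTop fun _ ↦ (0 : ℝ) := by
  rw [tendstoInMeasure_zero_iff] at *
  intro e he
  refine tendsto_of_tendsto_of_tendsto_of_le_of_le tendsto_const_nhds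
    (hf (e / (|c| + 1)) (by positivity)) (fun _ ↦ zero_le) fun n ↦ measure_mono fun ω hω ↦ ?_
  simp only [Set.mem_ofPred_eq, abs_mul] at hω ⊢
  rw [div_le_iff₀ (by positivity)]
  nlinarith [abs_nonneg (f n ω)]

lemma tendstoInMeasure_zero_sum {κ : Type*} {s : Finset κ} {f : κ → ℕ → Ω → ℝ}
    (hf : ∀ i, TendstoInMeasure P (f i) atTop fun _ ↦ (0 : ℝ)) :
    TendstoInMeasure P (fun n ω ↦ ∑ i ∈ s, f i n ω) atTop fun _ ↦ (0 : ℝ) := by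
  classical
  induction s using Finset.induction_on with
  | empty =>
    simp only [Finset.sum_empty]
    rw [tendstoInMeasure_zero_iff]
    intro e he
    simp [not_le.2 he]
  | insert a s ha ih =>
    simp only [Finset.sum_insert ha]
    exact tendstoInMeasure_zero_add (hf a) ih

/-- If finitely many real sequences converge to zero in probability, all of them are small with
probability tending to one. -/
lemma tendsto_measure_of_tendstoInMeasure_zero [IsProbabilityMeasure P] {κ : Type*} [Finite κ]
    {f : κ → ℕ → Ω → ℝ} (hf : ∀ i, TendstoInMeasure P (f i) atTop fun _ ↦ (0 : ℝ)) {e : ℝ}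
    (he : 0 < e) {A : ℕ → Set Ω}
    (hA : ∀ᶠ n in atTop, ∀ᵐ ω ∂P, (∀ i, |f i n ω| < e) → ω ∈ A n) :
    Tendsto (fun n ↦ P (A n)) atTop (𝓝 1) := by
  have := Fintype.ofFinite κ
  have h1 : Tendsto (fun n ↦ ∑ i, P {ω | e ≤ |f i n ω|}) atTop (𝓝 0) := by
    have := tendsto_finsetSum (Finset.univ : Finset κ)
      fun i _ ↦ tendstoInMeasure_zero_iff.1 (hf i) e he
    simpa using this
  have h2 : Tendsto (fun n ↦ 1 - ∑ i, P {ω | e ≤ |f i n ω|}) atTop (𝓝 1) := by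
    have := ENNReal.Tendsto.sub tendsto_const_nhds h1 (a := 1) (Or.inl ENNReal.one_ne_top)
    simpa using this
  refine tendsto_of_tendsto_of_tendsto_of_le_of_le' h2 tendsto_const_nhds ?_
    (Eventually.of_forall fun n ↦ prob_le_one)
  filter_upwards [hA] with n hn
  rw [tsub_le_iff_right]
  -- `A n` is not assumed measurable, so complements are avoided: `A n` and the bad events cover
  -- almost all of `Ω`, and subadditivity suffices.
  calc (1 : ℝ≥0∞) = P Set.univ := measure_univ.symm
    _ ≤ P (A n ∪ ⋃ i, {ω | e ≤ |f i n ω|}) := measure_mono_ae (by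
        filter_upwards [hn] with ω hω _
        by_cases h : ∀ i, |f i n ω| < e
        · exact Or.inl (hω h)
        · push Not at h
          exact Or.inr (Set.mem_iUnion.2 h))
    _ ≤ P (A n) + P (⋃ i, {ω | e ≤ |f i n ω|}) := measure_union_le _ _
    _ ≤ P (A n) + ∑ i, P {ω | e ≤ |f i n ω|} := by
        gcongr
        exact measure_iUnion_fintype_le _ _

end Probability

/-! ### Consistency of the realized covariance -/

section Decomposition

variable {Ω : Type*} {mΩ : MeasurableSpace Ω} {P : Measure Ω} {ℱ : Filtration ℝ≥0 mΩ}

/-- What remains after removing the noise is `c + ∫ b(Z)`, whose integrand is continuous along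
almost every path. -/
lemma SolvesSDE.lipOn_sub {d r : ℕ} {b : E d → E d} {S : Matrix (Fin d) (Fin r) ℝ}
    {W : ℝ≥0 → Ω → (Fin r → ℝ)} {c : E d} {Z : ℝ≥0 → Ω → E d} (h : SolvesSDE ℱ P b S W c Z)
    (hb : Continuous b) (T : ℝ≥0) :
    ∀ᵐ ω ∂P, ∀ i, LipOn T fun t ↦ Z t ω i - (S *ᵥ W t ω) i := by
  filter_upwards [h.continuous, h.eqn] with ω hc he i
  have hu : Continuous fun s : ℝ ↦ b (Z s.toNNReal ω) i := by fun_prop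
  have hl := (LipOn.const (T := T) (c i)).add (LipOn.integral hu)
  convert hl using 2 with t
  rw [he t i]
  ring

lemma SolvesSDE.measurable_apply {d r : ℕ} {b : E d → E d} {S : Matrix (Fin d) (Fin r) ℝ}
    {W : ℝ≥0 → Ω → (Fin r → ℝ)} {c : E d} {Z : ℝ≥0 → Ω → E d} (h : SolvesSDE ℱ P b S W c Z)
    (t : ℝ≥0) (i : Fin d) : Measurable fun ω ↦ Z t ω i := by
  have h1 : Measurable (Z t) := (h.adapted t).mono (ℱ.le t) le_rfl
  fun_prop

lemma DriftCondition.continuous {d : ℕ} {b : E d → E d} {Z : ℝ≥0 → Ω → E d}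
    (h : DriftCondition P b Z) : Continuous b := h.smooth.1.continuous

lemma IsWiener.measurable_apply {r : ℕ} {W : ℝ≥0 → Ω → (Fin r → ℝ)} (h : IsWiener ℱ P W)
    (t : ℝ≥0) (j : Fin r) : Measurable fun ω ↦ W t ω j := by
  have h1 : Measurable (W t) := (h.adapted t).mono (ℱ.le t) le_rfl
  fun_prop

variable {p₁ p₂ k₁ k₂ : ℕ} {r : Fin 4 → ℕ} {W : (i : Fin 4) → ℝ≥0 → Ω → (Fin (r i) → ℝ)}
  {D : DriftData p₁ p₂ k₁ k₂} {a : Param p₁ p₂ k₁ k₂ r} {Y : Processes Ω p₁ p₂ k₁ k₂}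

/-- The Gaussian part of the observed process. -/
noncomputable def gaussPart (a : Param p₁ p₂ k₁ k₂ r)
    (W : (i : Fin 4) → ℝ≥0 → Ω → (Fin (r i) → ℝ)) (t : ℝ≥0) (ω : Ω) (x : Fin p₁ ⊕ Fin p₂) : ℝ :=
  ∑ α : (Σ i, Fin (r i)), a.loading α.1 x α.2 * W α.1 t ω α.2

lemma gaussPart_inl (t : ℝ≥0) (ω : Ω) (x : Fin p₁) :
    gaussPart a W t ω (Sum.inl x) = (a.Λ₁ *ᵥ (a.S₁ *ᵥ W 0 t ω)) x + (a.S₂ *ᵥ W 1 t ω) x := by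
  have (i : Fin 4) : ∑ j, a.loading i (Sum.inl x) j * W i t ω j
      = (a.loading i *ᵥ W i t ω) (Sum.inl x) := rfl
  simp only [gaussPart, Fintype.sum_sigma, this, Fin.sum_univ_four]
  simp [Param.loading, Matrix.fromRows_mulVec]

lemma gaussPart_inr (t : ℝ≥0) (ω : Ω) (x : Fin p₂) :
    gaussPart a W t ω (Sum.inr x) = ((a.Λ₂ * a.Ψ⁻¹ * a.Γ) *ᵥ (a.S₁ *ᵥ W 0 t ω)) x
      + (a.S₃ *ᵥ W 2 t ω) x + ((a.Λ₂ * a.Ψ⁻¹) *ᵥ (a.S₄ *ᵥ W 3 t ω)) x := by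
  have (i : Fin 4) : ∑ j, a.loading i (Sum.inr x) j * W i t ω j
      = (a.loading i *ᵥ W i t ω) (Sum.inr x) := rfl
  simp only [gaussPart, Fintype.sum_sigma, this, Fin.sum_univ_four]
  simp [Param.loading, Matrix.fromRows_mulVec]

/-- Invertibility of `Ψ` solves the structural equation as `η = Ψ⁻¹ (Γ ξ + ζ)`, which eliminates
`η`. -/
lemma IsSEM.reduced_form (h : IsSEM ℱ P W D a Y) (ha : a.Admissible) :
    ∀ᵐ ω ∂P, ∀ t, (∀ x, Y.X t ω (Sum.inl x) = (a.Λ₁ *ᵥ (Y.ξ t ω).ofLp) x + Y.δ t ω x) ∧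
      ∀ x, Y.X t ω (Sum.inr x) = ((a.Λ₂ * a.Ψ⁻¹ * a.Γ) *ᵥ (Y.ξ t ω).ofLp) x
        + Y.ε t ω x + ((a.Λ₂ * a.Ψ⁻¹) *ᵥ (Y.ζ t ω).ofLp) x := by
  filter_upwards [h.eq_X₁, h.eq_X₂, h.eq_η] with ω h1 h2 h3 t
  refine ⟨fun x ↦ h1 t x, fun x ↦ ?_⟩
  have hη : (Y.η t ω).ofLp
      = a.Ψ⁻¹ *ᵥ (a.Γ *ᵥ (Y.ξ t ω).ofLp + (Y.ζ t ω).ofLp) := by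
    have h4 : a.Ψ *ᵥ (Y.η t ω).ofLp = a.Γ *ᵥ (Y.ξ t ω).ofLp + (Y.ζ t ω).ofLp := by
      ext i
      have := h3 t i
      simp only [Param.Ψ, Matrix.sub_mulVec, Matrix.one_mulVec, Pi.sub_apply, Pi.add_apply]
      linarith
    rw [← h4, Matrix.mulVec_mulVec,
      Matrix.nonsing_inv_mul _ ((Matrix.isUnit_iff_isUnit_det _).1 ha.nonsing), Matrix.one_mulVec]
  change Y.X₂ t ω x = _
  rw [h2 t x, hη]
  simp only [Matrix.mulVec_add, Matrix.mulVec_mulVec, Pi.add_apply, ← Matrix.mul_assoc]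
  ring

lemma IsSEM.lipOn_sub_gaussPart (h : IsSEM ℱ P W D a Y) (ha : a.Admissible)
    (hA : AssumptionA P D Y) (T : ℝ≥0) :
    ∀ᵐ ω ∂P, ∀ x, LipOn T fun t ↦ Y.X t ω x - gaussPart a W t ω x := by
  filter_upwards [h.reduced_form ha, h.sde_ξ.lipOn_sub hA.ξ.continuous T,
    h.sde_δ.lipOn_sub hA.δ.continuous T, h.sde_ε.lipOn_sub hA.ε.continuous T,
    h.sde_ζ.lipOn_sub hA.ζ.continuous T] with ω hX hξ hδ hε hζ x
  rcases x with x | x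
  · convert! (LipOn.mulVec a.Λ₁ (f := fun t ↦ (Y.ξ t ω).ofLp - a.S₁ *ᵥ W 0 t ω) hξ x).add (hδ x)
      using 2 with t
    rw [(hX t).1 x, gaussPart_inl, Matrix.mulVec_sub, Pi.sub_apply]
    ring
  · convert! ((LipOn.mulVec (a.Λ₂ * a.Ψ⁻¹ * a.Γ)
      (f := fun t ↦ (Y.ξ t ω).ofLp - a.S₁ *ᵥ W 0 t ω) hξ x).add (hε x)).add
      (LipOn.mulVec (a.Λ₂ * a.Ψ⁻¹) (f := fun t ↦ (Y.ζ t ω).ofLp - a.S₄ *ᵥ W 3 t ω) hζ x)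
      using 2 with t
    rw [(hX t).2 x, gaussPart_inr, Matrix.mulVec_sub, Matrix.mulVec_sub, Pi.sub_apply, Pi.sub_apply]
    ring

/-- The observed process is only determined almost surely by the model equations. Measurability is
needed to pass from almost sure convergence to convergence in measure. -/
lemma IsSEM.aemeasurable_X (h : IsSEM ℱ P W D a Y) (ha : a.Admissible) (t : ℝ≥0)
    (x : Fin p₁ ⊕ Fin p₂) : AEMeasurable (fun ω ↦ Y.X t ω x) P := by
  have hm {m d : ℕ} (A : Matrix (Fin m) (Fin d) ℝ) {Z : Ω → E d}
      (hZ : ∀ i, Measurable fun ω ↦ Z ω i) (x : Fin m) :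
      Measurable fun ω ↦ (A *ᵥ (Z ω).ofLp) x := by
    simp only [Matrix.mulVec, dotProduct]
    exact Finset.measurable_sum _ fun i _ ↦ (hZ i).const_mul _
  rcases x with x | x
  · refine AEMeasurable.congr (f := fun ω ↦ (a.Λ₁ *ᵥ (Y.ξ t ω).ofLp) x + Y.δ t ω x) ?_ ?_
    · exact ((hm _ (h.sde_ξ.measurable_apply t) x).add
        (h.sde_δ.measurable_apply t x)).aemeasurable
    · filter_upwards [h.reduced_form ha] with ω hω
      exact ((hω t).1 x).symm
  · refine AEMeasurable.congr (f := fun ω ↦ ((a.Λ₂ * a.Ψ⁻¹ * a.Γ) *ᵥ (Y.ξ t ω).ofLp) x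
        + Y.ε t ω x + ((a.Λ₂ * a.Ψ⁻¹) *ᵥ (Y.ζ t ω).ofLp) x) ?_ ?_
    · exact (((hm _ (h.sde_ξ.measurable_apply t) x).add (h.sde_ε.measurable_apply t x)).add
        (hm _ (h.sde_ζ.measurable_apply t) x)).aemeasurable
    · filter_upwards [h.reduced_form ha] with ω hω
      exact ((hω t).2 x).symm

lemma IsSEM.measurable_gaussPart (h : IsSEM ℱ P W D a Y) (t : ℝ≥0) (x : Fin p₁ ⊕ Fin p₂) :
    Measurable fun ω ↦ gaussPart a W t ω x := by
  unfold gaussPart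
  exact Finset.measurable_sum _ fun α _ ↦ ((h.wiener α.1).measurable_apply t α.2).const_mul _

lemma IsSEM.continuous_gaussPart (h : IsSEM ℱ P W D a Y) :
    ∀ᵐ ω ∂P, ∀ x, Continuous fun t ↦ gaussPart a W t ω x := by
  have : ∀ᵐ ω ∂P, ∀ α : (Σ i, Fin (r i)), Continuous fun t ↦ W α.1 t ω α.2 :=
    ae_all_iff.2 fun α ↦ ((h.wiener α.1).brownian α.2).cont
  filter_upwards [this] with ω hω x
  unfold gaussPart
  fun_prop

lemma IsSEM.indepFun_coord (h : IsSEM ℱ P W D a Y) {α β : Σ i, Fin (r i)} (hαβ : α ≠ β) :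
    (fun ω t ↦ W α.1 t ω α.2) ⟂ᵢ[P] (fun ω t ↦ W β.1 t ω β.2) := by
  obtain ⟨i, j⟩ := α
  obtain ⟨i', j'⟩ := β
  by_cases hi : i = i'
  · subst hi
    have hj : j ≠ j' := fun hj ↦ hαβ (by rw [hj])
    exact (h.wiener i).indep_coord.indepFun hj
  · have h1 := h.indep.indepFun hi
    exact h1.comp (φ := fun w (t : ℝ≥0) ↦ w t j) (ψ := fun w (t : ℝ≥0) ↦ w t j')
      (by fun_prop) (by fun_prop)

/-- The realized covariation of the driving Wiener processes is consistent. -/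
lemma IsSEM.tendsto_realized_noise [IsProbabilityMeasure P] (h : IsSEM ℱ P W D a Y) (T : ℝ≥0)
    (α β : Σ i, Fin (r i)) :
    TendstoInMeasure P (fun n ω ↦ (∑ i ∈ Finset.range n,
      stepIncr (fun t ω ↦ W α.1 t ω α.2) (T / n) i ω
        * stepIncr (fun t ω ↦ W β.1 t ω β.2) (T / n) i ω) - if α = β then (T : ℝ) else 0)
      atTop fun _ ↦ (0 : ℝ) := by
  rw [tendstoInMeasure_zero_iff]
  intro e he
  by_cases hαβ : α = β
  · subst hαβ
    simpa only [if_true] using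
      tendsto_realized_variance ((h.wiener α.1).brownian α.2).toIsPreBrownianReal T he
  · simpa only [if_neg hαβ, sub_zero] using
      tendsto_realized_covariance ((h.wiener α.1).brownian α.2).toIsPreBrownianReal
        ((h.wiener β.1).brownian β.2).toIsPreBrownianReal (h.indepFun_coord hαβ) T he

lemma stepIncr_gaussPart (x : Fin p₁ ⊕ Fin p₂) (s : ℝ≥0) (i : ℕ) (ω : Ω) :
    stepIncr (fun t ω ↦ gaussPart a W t ω x) s i ω
      = ∑ α : (Σ i, Fin (r i)), a.loading α.1 x α.2 * stepIncr (fun t ω ↦ W α.1 t ω α.2) s i ω := by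
  simp only [stepIncr, gaussPart, mul_sub, Finset.sum_sub_distrib]

lemma cov_apply_eq_sum_loading (a : Param p₁ p₂ k₁ k₂ r) (x y : Fin p₁ ⊕ Fin p₂) :
    a.cov x y = ∑ α : (Σ i, Fin (r i)), a.loading α.1 x α.2 * a.loading α.1 y α.2 := by
  rw [a.cov_eq_sum_loading, Matrix.sum_apply, Fintype.sum_sigma]
  rfl

/-- By bilinearity the error is a finite linear combination of the errors for pairs of scalar Wiener
processes. Only the diagonal pairs have a nonzero limit, and they sum to the covariance. -/
lemma IsSEM.tendsto_realized_gaussPart [IsProbabilityMeasure P] (h : IsSEM ℱ P W D a Y) (T : ℝ≥0)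
    (x y : Fin p₁ ⊕ Fin p₂) :
    TendstoInMeasure P (fun n ω ↦ (∑ i ∈ Finset.range n,
      stepIncr (fun t ω ↦ gaussPart a W t ω x) (T / n) i ω
        * stepIncr (fun t ω ↦ gaussPart a W t ω y) (T / n) i ω) - T * a.cov x y)
      atTop fun _ ↦ (0 : ℝ) := by
  have hsum := tendstoInMeasure_zero_sum (s := Finset.univ) fun α : (Σ i, Fin (r i)) ↦
    tendstoInMeasure_zero_sum (s := Finset.univ) fun β : (Σ i, Fin (r i)) ↦
      tendstoInMeasure_zero_const_mul (h.tendsto_realized_noise T α β)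
        (a.loading α.1 x α.2 * a.loading β.1 y β.2)
  convert! hsum using 3 with n ω
  simp only [stepIncr_gaussPart, mul_sub, Finset.sum_sub_distrib]
  congr 1
  · simp_rw [Finset.sum_mul_sum]
    simp only [Finset.mul_sum]
    rw [Finset.sum_comm]
    refine Finset.sum_congr rfl fun α _ ↦ ?_
    rw [Finset.sum_comm]
    refine Finset.sum_congr rfl fun β _ ↦ Finset.sum_congr rfl fun i _ ↦ ?_
    ring
  · simp only [mul_ite, mul_zero, Finset.sum_ite_eq, Finset.mem_univ, if_true]
    rw [cov_apply_eq_sum_loading, Finset.mul_sum]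
    exact Finset.sum_congr rfl fun α _ ↦ by ring

/-- Consistency of the realized covariance of the observed process. -/
lemma IsSEM.tendsto_realizedCov [IsProbabilityMeasure P] (h : IsSEM ℱ P W D a Y)
    (ha : a.Admissible) (hA : AssumptionA P D Y) {T : ℝ≥0} (hT : 0 < T)
    (x y : Fin p₁ ⊕ Fin p₂) :
    TendstoInMeasure P (fun n ω ↦ realizedCov (T : ℝ) n (incr Y.X T n ω) x y - a.cov x y)
      atTop fun _ ↦ (0 : ℝ) := by
  have hT0 : (T : ℝ) ≠ 0 := by exact_mod_cast hT.ne'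
  set X : (Fin p₁ ⊕ Fin p₂) → ℝ≥0 → Ω → ℝ := fun x t ω ↦ Y.X t ω x with hX
  set G : (Fin p₁ ⊕ Fin p₂) → ℝ≥0 → Ω → ℝ := fun x t ω ↦ gaussPart a W t ω x with hG
  have hXm (n i : ℕ) (x : Fin p₁ ⊕ Fin p₂) : AEMeasurable (stepIncr (X x) (T / n) i) P :=
    (h.aemeasurable_X ha _ x).sub (h.aemeasurable_X ha _ x)
  have hGm (n i : ℕ) (x : Fin p₁ ⊕ Fin p₂) : AEMeasurable (stepIncr (G x) (T / n) i) P :=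
    ((h.measurable_gaussPart _ x).sub (h.measurable_gaussPart _ x)).aemeasurable
  have hrem : TendstoInMeasure P (fun n ω ↦ ∑ i ∈ Finset.range n,
      (stepIncr (X x) (T / n) i ω * stepIncr (X y) (T / n) i ω
        - stepIncr (G x) (T / n) i ω * stepIncr (G y) (T / n) i ω)) atTop fun _ ↦ (0 : ℝ) := by
    refine tendstoInMeasure_of_tendsto_ae (fun n ↦ AEMeasurable.aestronglyMeasurable ?_) ?_
    · exact Finset.aemeasurable_fun_sum _ fun i _ ↦
        ((hXm n i x).mul (hXm n i y)).sub ((hGm n i x).mul (hGm n i y))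
    · filter_upwards [h.lipOn_sub_gaussPart ha hA T, h.continuous_gaussPart] with ω hL hc
      have hXc : ContinuousOn (fun t ↦ X x t ω) (Set.Iic T) := by
        refine ((hL x).continuousOn.add (hc x).continuousOn).congr fun t _ ↦ ?_
        simp [hX]
      -- With `R = X - G` Lipschitz, `ΔXₓ ΔX_y - ΔGₓ ΔG_y = ΔXₓ ΔR_y + ΔG_y ΔRₓ`, and both sums
      -- vanish pathwise.
      have h1 := tendsto_sum_incr_mul_incr hXc (hL y)
      have h2 := tendsto_sum_incr_mul_incr (hc y).continuousOn (hL x)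
      have h3 := h1.add h2
      rw [add_zero] at h3
      refine h3.congr fun n ↦ ?_
      rw [← Finset.sum_add_distrib]
      refine Finset.sum_congr rfl fun i _ ↦ ?_
      simp only [stepIncr, hX, hG]
      ring
  have hall := tendstoInMeasure_zero_const_mul
    (tendstoInMeasure_zero_add hrem (h.tendsto_realized_gaussPart T x y)) (T : ℝ)⁻¹
  convert! hall using 3 with n ω
  simp only [realizedCov, Matrix.smul_apply, Matrix.sum_apply, Matrix.vecMulVec_apply, smul_eq_mul,
    Finset.sum_sub_distrib]
  rw [sub_add_sub_cancel, mul_sub, inv_mul_cancel_left₀ hT0]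
  rfl

end Decomposition

end DiffSEM

theorem theorem3
    {p₁ p₂ k₁ k₂ M : ℕ} {r : Fin 4 → ℕ}
    (hp₁ : p₁ ≠ 0) (hp₂ : p₂ ≠ 0) (hk₁ : k₁ ≤ p₁) (hk₂ : k₂ ≤ p₂)
    -- the stochastic basis
    {Ω : Type*} {mΩ : MeasurableSpace Ω} (P : Measure Ω) [IsProbabilityMeasure P]
    (ℱ : Filtration ℝ≥0 mΩ) (hℱ : UsualConditions ℱ P)
    -- the true model
    (W : (i : Fin 4) → ℝ≥0 → Ω → (Fin (r i) → ℝ))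
    (D : DriftData p₁ p₂ k₁ k₂) (a₀ : Param p₁ p₂ k₁ k₂ r) (ha₀ : a₀.Admissible)
    (Y : Processes Ω p₁ p₂ k₁ k₂) (hY : IsSEM ℱ P W D a₀ Y)
    (T : ℝ≥0) (hT : 0 < T)
    -- the candidate models, their estimators, priors and optimal parameters
    (model : Fin M → Model p₁ p₂ k₁ k₂ r) (hmodel : ∀ m, (model m).Regular)
    (θhat : (m : Fin M) → ℕ → Ω → E (model m).q)
    (hθhat : ∀ m, (model m).IsQMLE P Y.X T (θhat m))
    (π : (m : Fin M) → ℕ → E (model m).q → ℝ) (hπ : ∀ m, IsPrior (model m).Θ (π m))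
    (θbar : (m : Fin M) → E (model m).q)
    (hA : AssumptionA P D Y)
    (hB : ∀ m, AssumptionB (model m).Θ (model m).cov a₀.cov (π m))
    (hC2 : ∀ m, AssumptionC2 (model m).Θ (model m).cov a₀.cov (θbar m))
    (mstar : Fin M) (hmstar : IsOptimalModel model a₀.cov mstar)
    (m : Fin M) (hm : ¬ (model m).Correct a₀.cov) :
    Tendsto (fun n : ℕ ↦ P {ω | (model mstar).QBIC₁ Y.X T (θhat mstar) n ω
        < (model m).QBIC₁ Y.X T (θhat m) n ω}) atTop (𝓝 1) ∧
    Tendsto (fun n : ℕ ↦ P {ω | (model mstar).QBIC₂ Y.X T (θhat mstar) n ω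
        < (model m).QBIC₂ Y.X T (θhat m) n ω}) atTop (𝓝 1) := by
  have hpd (j : Fin M) : ∀ θ ∈ (model j).Θ, ((model j).cov θ).PosDef :=
    fun θ hθ ↦ ((hmodel j).admissible θ hθ).posDef_cov
  have hdet (j : Fin M) : ∀ θ ∈ (model j).Θ, 0 < ((model j).cov θ).det :=
    fun θ hθ ↦ (hpd j θ hθ).det_pos
  -- A convex set with interior points determines derivatives within it even at its boundary.
  have hud (j : Fin M) : UniqueDiffOn ℝ (model j).Θ :=
    uniqueDiffOn_convex (hmodel j).convex (hmodel j).interior_nonempty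
  have hlt : limitContrast a₀.cov ((model m).cov (θbar m))
      < limitContrast a₀.cov ((model mstar).cov (θbar mstar)) := by
    obtain ⟨θ₀, hθ₀, heq⟩ := hmstar.1
    -- Misspecification makes the covariance at `θbar m` differ from the truth, so its contrast is
    -- strictly below the value at the truth, which `mstar` attains by correctness.
    refine (limitContrast_lt_self ha₀.posDef_cov (hpd m _ (hC2 m).mem)
      fun h ↦ hm ⟨θbar m, (hC2 m).mem, h.symm⟩).trans_le ?_
    have := (hC2 mstar).isMax θ₀ hθ₀
    rwa [← heq] at this
  obtain ⟨N, hN⟩ := eventually_qbic_lt (hC2 mstar) (hud mstar) (hmodel mstar).compact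
    (hmodel mstar).smooth (fun θ hθ ↦ (hdet mstar θ hθ).ne') (hC2 m) (hud m) (hmodel m).compact
    (hmodel m).smooth (fun θ hθ ↦ (hdet m θ hθ).ne') hlt
  -- A neighbourhood of the true covariance contains an entrywise ball, so entrywise convergence in
  -- probability suffices.
  obtain ⟨e, he, hball⟩ : ∃ e : ℝ, 0 < e ∧ ∀ Q : Matrix (Fin p₁ ⊕ Fin p₂) (Fin p₁ ⊕ Fin p₂) ℝ,
      (∀ z : (Fin p₁ ⊕ Fin p₂) × (Fin p₁ ⊕ Fin p₂), |Q z.1 z.2 - a₀.cov z.1 z.2| < e) →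
      ∀ n ≥ N, ∀ (H : E (model mstar).q → ℝ) (H' : E (model m).q → ℝ),
      (∀ θ ∈ (model mstar).Θ, H θ = n * limitContrast Q ((model mstar).cov θ)) →
      (∀ θ ∈ (model m).Θ, H' θ = n * limitContrast Q ((model m).cov θ)) →
      ∀ θ ∈ (model mstar).Θ, IsMaxOn H (model mstar).Θ θ →
      ∀ θ' ∈ (model m).Θ, IsMaxOn H' (model m).Θ θ' →
      qbic₁ H (model mstar).Θ n θ < qbic₁ H' (model m).Θ n θ' ∧ qbic₂ H n θ < qbic₂ H' n θ' := by
    obtain ⟨e, he, hball⟩ := Metric.eventually_nhds_iff.1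
      (show ∀ᶠ Q : (Fin p₁ ⊕ Fin p₂) → (Fin p₁ ⊕ Fin p₂) → ℝ in 𝓝 a₀.cov, _ from hN)
    exact ⟨e, he, fun Q hQ ↦ hball
      ((dist_pi_lt_iff he).2 fun x ↦ (dist_pi_lt_iff he).2 fun y ↦ hQ (x, y))⟩
  have hT0 : (0 : ℝ) < T := by exact_mod_cast hT
  have hae : ∀ᶠ n : ℕ in atTop, ∀ᵐ ω ∂P,
      (∀ z : (Fin p₁ ⊕ Fin p₂) × (Fin p₁ ⊕ Fin p₂),
        |realizedCov (T : ℝ) n (incr Y.X T n ω) z.1 z.2 - a₀.cov z.1 z.2| < e) →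
      (model mstar).QBIC₁ Y.X T (θhat mstar) n ω < (model m).QBIC₁ Y.X T (θhat m) n ω ∧
      (model mstar).QBIC₂ Y.X T (θhat mstar) n ω < (model m).QBIC₂ Y.X T (θhat m) n ω := by
    filter_upwards [eventually_ge_atTop N, eventually_ge_atTop 1] with n hnN hn1
    have hn0 : (0 : ℝ) < n := by exact_mod_cast hn1
    filter_upwards [hθhat mstar n hn1, hθhat m n hn1] with ω h1 h2 hω
    exact hball _ hω n hnN _ _
      (fun θ hθ ↦ quasiLogLik_eq (hdet mstar θ hθ) hT0 hn1 _)
      (fun θ hθ ↦ quasiLogLik_eq (hdet m θ hθ) hT0 hn1 _)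
      _ h1.1 (isMaxOn_quasiLogLik (hdet mstar) (by positivity) n _ h1.2)
      _ h2.1 (isMaxOn_quasiLogLik (hdet m) (by positivity) n _ h2.2)
  have hconv (z : (Fin p₁ ⊕ Fin p₂) × (Fin p₁ ⊕ Fin p₂)) :=
    hY.tendsto_realizedCov ha₀ hA hT z.1 z.2
  exact ⟨tendsto_measure_of_tendstoInMeasure_zero hconv he
      (hae.mono fun n hn ↦ hn.mono fun ω hω h ↦ (hω h).1),
    tendsto_measure_of_tendstoInMeasure_zero hconv he
      (hae.mono fun n hn ↦ hn.mono fun ω hω h ↦ (hω h).2)⟩
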